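/- Let $\Sigma$ be a finite alphabet with $0,1\in\Sigma$, $0\neq 1$. Let $\Sigma^*$ (finite words) carry the discrete topology and $\Sigma^\omega$ (infinite sequences) the Cantor topology, whose basic open sets are $u\Sigma^\omega$, $u\in\Sigma^*$. A *Type-2 machine* with $k\ge 0$ input tapes is a multi-tape Turing machine with $k$ read-only input tapes (each holding an element of $\Sigma^\omega$), finitely many work tapes and one one-way output tape. With output type $\Sigma^*$ it computes $w$ on input $p$ iff it halts on $p$ with $w$ on the output tape; with output type $\Sigma^\omega$ it computes $q$ on input $p$ iff it computes forever and writes $q$ on the output tape. A partial function $f:\subseteq(\Sigma^\omega)^k\to Y$, $Y\in\{\Sigma^*,\Sigma^\omega\}$, is *computable* iff it has an extension that is exactly the partial function computed by some Type-2 machine. A partial function is *continuous* iff it is continuous on its domain with the subspace topology. A *generalized Turing machine* $N$ on $\Sigma^\omega$ has a finite label set with an initial label $l_0$ and a final label $l_f$, a finite work alphabet $\Gamma$ disjoint from $\Sigma$ and from $\Sigma^\omega$ with a blank symbol $b\in\Gamma$, and numbers $k\le L$. It has tapes $0,\dots,L$, each a two-way infinite sequence of cells indexed by $\mathbb Z$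 with contents in $\Sigma^\omega\cup\Gamma$, and one head on each tape; tape $0$ is the output tape and tapes $1,\dots,k$ are the input tapes. To every label $l\neq l_f$ one statement is assigned, of one of the forms ($x_i$ denotes the content of the cell scanned on tape $i$, and $n\geq 0$): move the head on tape $i$ one cell to the right, or to the left, and go to $l'$; write $a\in\Gamma$ on the scanned cell of tape $i$ and go to $l'$; go to $l'$ if $x_i=a$ and to $l''$ otherwise ($a\in\Gamma$); an assignment "$i:=f(i_1,\dots,i_n)$, go to $l'$" with a multi-function $f$ from $(\Sigma^\omega)^n$ to $\Sigma^\omega$ (write some element of $f(x_{i_1},\dots,x_{i_n})$ on the scanned cell of tape $i$); a test "if $f(i_1,\dots,i_n)$ then $l'$ else $l''$" with a partial function $f:\subseteq(\Sigma^\omega)^n\to\Sigma^*$, $\mathrm{range}(f)\subseteq\{0,1\}$ (go to $l'$ if $f(x_{i_1},\dots,x_{i_n})=0$, to $l''$ if it is $1$). An assignment or a test has no successor configuration if some $x_{i_j}\in\Gamma$ or if $f(x_{i_1},\dots,x_{i_n})$ is empty, respectively undefined. A computation is a finite non-empty or infinite sequence of configurations in which each is a successor of the preceding one; it is maximal if it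 is infinite or its last configuration has no successor; it is accepting if it is finite and its last configuration has label $l_f$ and an element of $\Sigma^\omega$ in cell $0$ of tape $0$, which is its result. The initial configuration for $(p_1,\dots,p_k)\in(\Sigma^\omega)^k$ has label $l_0$, all heads on cell $0$, $p_i$ in cell $0$ of tape $i$ for $1\le i\le k$, and $b$ in all other cells. The multi-function $f_N$ from $(\Sigma^\omega)^k$ to $\Sigma^\omega$ computed by $N$ is defined by: $q\in f_N(p)$ iff every maximal computation from the initial configuration for $p$ is accepting and some accepting computation from it has result $q$. **Theorem.** Let $N$ be a generalized Turing machine on $\Sigma^\omega$. 1. If every function occurring in an assignment of $N$ is a (single-valued) continuous partial function $:\subseteq(\Sigma^\omega)^n\to\Sigma^\omega$ and every function occurring in a test of $N$ is a continuous partial function $:\subseteq(\Sigma^\omega)^n\to\Sigma^*$, then $f_N$ is a (single-valued) continuous partial function $:\subseteq(\Sigma^\omega)^k\to\Sigma^\omega$. 2. If every function occurring in an assignment of $N$ is a (single-valued) computable partial function $:\subseteq(\Sigma^\omega)^n\to\Sigma^\omega$ and every function occurring in a test of $N$ is a computable partial function $:\subseteq(\Sigma^\omega)^n\to\Sigma^*$,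 then $f_N$ is a (single-valued) computable partial function $:\subseteq(\Sigma^\omega)^k\to\Sigma^\omega$. -/

import Mathlib

namespace TTE

universe u v

/-! ## Words, sequences and their topologies -/

/-- Finite words over `A`. -/
def FinWord (A : Type u) : Type u := List A

/-- Infinite sequences over `A`. -/
def OmegaWord (A : Type u) : Type u := ℕ → A

/-- The set of finite words carries the discrete topology. -/
instance instTopologicalSpaceFinWord (A : Type u) : TopologicalSpace (FinWord A) := ⊥

/-- The Cantor topology on infinite sequences: the product of the discrete topologies on `A`;
the cylinders (all extensions of one finite word) form a basis. -/
instance instTopologicalSpaceOmegaWord (A : Type u) : TopologicalSpace (OmegaWord A) :=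
  @Pi.topologicalSpace ℕ (fun _ => A) (fun _ => ⊥)

/-! ## Multi-functions and partial functions -/

/-- A multi-function from `X` to `Y`, given by the set of admissible values at each point. -/
abbrev MultiFun (X : Type u) (Y : Type v) : Type (max u v) := X → Set Y

/-- A partial function, regarded as a multi-function with at most one value at each point. -/
def MultiFun.ofPFun {X : Type u} {Y : Type v} (g : X →. Y) : MultiFun X Y :=
  fun x => {y | y ∈ g x}

/-- A partial function is continuous if it is continuous on its domain, with the subspace
topology. Nothing is required of the domain. -/
def PFunContinuous {X : Type u} {Y : Type v} [TopologicalSpace X] [TopologicalSpace Y]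
    (f : X →. Y) : Prop :=
  Continuous (fun x : f.Dom => f.fn x.1 x.2)

/-- `f` extends `g`, for partial functions. -/
def PFunExtends {X : Type u} {Y : Type v} (f g : X →. Y) : Prop :=
  ∀ x y, y ∈ g x → y ∈ f x

/-! ## Type-2 machines -/

/-- A Type-2 machine with `k` input tapes, each holding an infinite sequence over `A`. There are
`k` read-only input tapes that are infinite to the right, finitely many two-way infinite work
tapes over a finite alphabet whose blank symbol is `default`, and a single one-way write-only
output tape. Depending on the control state and the scanned symbols, the machine either halts
(`none`) or passes to a new control state, moves the input heads, writes on the work tapes and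
then moves their heads, and appends at most one symbol to the output. A head for which the
direction `none` is given stays where it is. -/
structure TypeTwoMachine (A : Type u) (k : ℕ) where
  State : Type
  [finiteState : Finite State]
  start : State
  workTapes : ℕ
  Work : Type
  [inhabitedWork : Inhabited Work]
  [finiteWork : Finite Work]
  next : State → (Fin k → A) → (Fin workTapes → Work) →
    Option (State × (Fin k → Option Turing.Dir) ×
      (Fin workTapes → Work × Option Turing.Dir) × Option A)

namespace TypeTwoMachine

attribute [instance] finiteState inhabitedWork finiteWork

variable {A : Type u} {k : ℕ}

/-- A configuration: the control state, the positions of the input heads, the work tapes, and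
the word on the output tape. -/
structure Config (M : TypeTwoMachine A k) where
  state : M.State
  inputHead : Fin k → ℕ
  work : Fin M.workTapes → Turing.Tape M.Work
  out : List A

/-- The initial configuration: input heads on the first symbol, blank work and output tapes. -/
def init (M : TypeTwoMachine A k) : M.Config where
  state := M.start
  inputHead := fun _ => 0
  work := fun _ => Turing.Tape.mk₁ []
  out := []

/-- The motion of an input head; moving left from the first cell has no effect. -/
def moveInput : Option Turing.Dir → ℕ → ℕ
  | none, n => n
  | some Turing.Dir.left, n => n - 1
  | some Turing.Dir.right, n => n + 1

/-- The action on a work tape: write, then move. -/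
def actWork {W : Type} [Inhabited W] (a : W × Option Turing.Dir) (T : Turing.Tape W) :
    Turing.Tape W :=
  match a.2 with
  | none => T.write a.1
  | some d => (T.write a.1).move d

/-- One step on input `p`; `none` if the machine halts in the configuration `c`. -/
def step (M : TypeTwoMachine A k) (p : Fin k → OmegaWord A) (c : M.Config) : Option M.Config :=
  (M.next c.state (fun i => p i (c.inputHead i)) (fun j => (c.work j).head)).map fun t =>
    { state := t.1
      inputHead := fun i => moveInput (t.2.1 i) (c.inputHead i)
      work := fun j => actWork (t.2.2.1 j) (c.work j)
      out := c.out ++ t.2.2.2.toList }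

/-- The configuration after `n` steps on input `p`; `none` if the machine has halted earlier. -/
def run (M : TypeTwoMachine A k) (p : Fin k → OmegaWord A) : ℕ → Option M.Config
  | 0 => some M.init
  | n + 1 => (M.run p n).bind (M.step p)

/-- On input `p` the machine halts with the word `w` on the output tape. -/
def OutputsWord (M : TypeTwoMachine A k) (p : Fin k → OmegaWord A) (w : FinWord A) : Prop :=
  ∃ (n : ℕ) (c : M.Config), M.run p n = some c ∧ M.step p c = none ∧ c.out = w

/-- On input `p` the machine computes forever and writes the infinite sequence `q` on the output
tape. -/
def OutputsSeq (M : TypeTwoMachine A k) (p : Fin k → OmegaWord A) (q : OmegaWord A) : Prop :=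
  (∀ n : ℕ, ∃ c : M.Config, M.run p n = some c) ∧
    ∀ j : ℕ, ∃ (n : ℕ) (c : M.Config), M.run p n = some c ∧ c.out[j]? = some (q j)

end TypeTwoMachine

/-- `f` is the function computed by some Type-2 machine with output type "finite word". -/
def TuringComputableWord {A : Type u} {k : ℕ} (f : (Fin k → OmegaWord A) →. FinWord A) : Prop :=
  ∃ M : TypeTwoMachine A k, ∀ p w, w ∈ f p ↔ M.OutputsWord p w

/-- `f` is the function computed by some Type-2 machine with output type "infinite sequence". -/
def TuringComputableSeq {A : Type u} {k : ℕ} (f : (Fin k → OmegaWord A) →. OmegaWord A) : Prop :=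
  ∃ M : TypeTwoMachine A k, ∀ p q, q ∈ f p ↔ M.OutputsSeq p q

/-- `f` is computable if it has a Turing computable extension (output type "finite word"). -/
def ComputableWord {A : Type u} {k : ℕ} (f : (Fin k → OmegaWord A) →. FinWord A) : Prop :=
  ∃ g : (Fin k → OmegaWord A) →. FinWord A, TuringComputableWord g ∧ PFunExtends g f

/-- `f` is computable if it has a Turing computable extension (output type "infinite
sequence"). -/
def ComputableSeq {A : Type u} {k : ℕ} (f : (Fin k → OmegaWord A) →. OmegaWord A) : Prop :=
  ∃ g : (Fin k → OmegaWord A) →. OmegaWord A, TuringComputableSeq g ∧ PFunExtends g f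

/-! ## Generalized Turing machines -/

/-- The statements of a generalized Turing machine with tapes `0, …, L`, tape sets `X i`, work
alphabet `Γ` and label set `Lab`. The tests take values in the words `0` and `1` over `A`. -/
inductive Stmt (A : Type u) [Zero A] [One A] {L : ℕ} (X : Fin (L + 1) → Type v) (Γ Lab : Type) :
    Type (max u v) where
  /-- Move the head on tape `i` to the right and go to `l`. -/
  | right (i : Fin (L + 1)) (l : Lab)
  /-- Move the head on tape `i` to the left and go to `l`. -/
  | left (i : Fin (L + 1)) (l : Lab)
  /-- Write `a` on the scanned cell of tape `i` and go to `l`. -/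
  | write (i : Fin (L + 1)) (a : Γ) (l : Lab)
  /-- Go to `l₁` if `a` is scanned on tape `i`, and to `l₂` otherwise. -/
  | ifSymbol (i : Fin (L + 1)) (a : Γ) (l₁ l₂ : Lab)
  /-- The assignment `i := f(i₁, …, iₙ)` for a multi-function `f`; then go to `l`. -/
  | assign (i : Fin (L + 1)) (n : ℕ) (arg : Fin n → Fin (L + 1))
      (f : MultiFun (∀ j, X (arg j)) (X i)) (l : Lab)
  /-- Go to `l₁` if `f(i₁, …, iₙ) = 0`, and to `l₂` if `f(i₁, …, iₙ) = 1`. -/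
  | test (n : ℕ) (arg : Fin n → Fin (L + 1)) (f : (∀ j, X (arg j)) →. FinWord A)
      (range_subset : ∀ x, ∀ w ∈ f x, w = ([0] : List A) ∨ w = ([1] : List A)) (l₁ l₂ : Lab)

/-- A generalized Turing machine with tapes `0, …, L`, of which `0` is the output tape and
`1, …, k` are the input tapes, with tape sets `X i`. -/
structure GTM (A : Type u) [Zero A] [One A] (k L : ℕ) (X : Fin (L + 1) → Type v) where
  Label : Type
  [finiteLabel : Finite Label]
  initial : Label
  final : Label
  Γ : Type
  [finiteΓ : Finite Γ]
  blank : Γ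
  k_le_L : k ≤ L
  stm : {l : Label // l ≠ final} → Stmt A X Γ Label

namespace GTM

attribute [instance] finiteLabel finiteΓ

variable {A : Type u} [Zero A] [One A] {k L : ℕ} {X : Fin (L + 1) → Type v}

/-- The number of the `i`-th input tape (counted from `0`), that is, `i + 1`. -/
def inputTape (M : GTM A k L X) (i : Fin k) : Fin (L + 1) :=
  (Fin.castLE M.k_le_L i).succ

/-- A configuration: the current label, the inscription of each tape, and the head positions.
The disjoint union makes the tape sets disjoint from the work alphabet. -/
structure Config (M : GTM A k L X) where
  label : M.Label
  tape : ∀ i : Fin (L + 1), ℤ → X i ⊕ M.Γ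
  head : Fin (L + 1) → ℤ

/-- The content of the cell scanned on tape `i`. -/
def Config.scanned {M : GTM A k L X} (κ : M.Config) (i : Fin (L + 1)) : X i ⊕ M.Γ :=
  κ.tape i (κ.head i)

/-- Replace the label. -/
def Config.setLabel {M : GTM A k L X} (κ : M.Config) (l : M.Label) : M.Config :=
  { κ with label := l }

/-- Move the head on tape `i` to position `m`. -/
def Config.setHead {M : GTM A k L X} (κ : M.Config) (i : Fin (L + 1)) (m : ℤ) : M.Config :=
  { κ with head := Function.update κ.head i m }

/-- Write `x` under the head of tape `i`. -/
def Config.setCell {M : GTM A k L X} (κ : M.Config) (i : Fin (L + 1)) (x : X i ⊕ M.Γ) :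
    M.Config :=
  { κ with tape := Function.update κ.tape i (Function.update (κ.tape i) (κ.head i) x) }

/-- The effect of a statement: `κ'` is one of the successors of `κ` under it. -/
def Effect (M : GTM A k L X) (κ κ' : M.Config) : Stmt A X M.Γ M.Label → Prop
  | .right i l => κ' = (κ.setHead i (κ.head i + 1)).setLabel l
  | .left i l => κ' = (κ.setHead i (κ.head i - 1)).setLabel l
  | .write i a l => κ' = (κ.setCell i (Sum.inr a)).setLabel l
  | .ifSymbol i a l₁ l₂ =>
      (κ.scanned i = Sum.inr a ∧ κ' = κ.setLabel l₁) ∨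
      (κ.scanned i ≠ Sum.inr a ∧ κ' = κ.setLabel l₂)
  | .assign i _ arg f l =>
      ∃ x : ∀ j, X (arg j), (∀ j, κ.scanned (arg j) = Sum.inl (x j)) ∧
        ∃ y ∈ f x, κ' = (κ.setCell i (Sum.inl y)).setLabel l
  | .test _ arg f _ l₁ l₂ =>
      ∃ x : ∀ j, X (arg j), (∀ j, κ.scanned (arg j) = Sum.inl (x j)) ∧
        ((([0] : List A) ∈ f x ∧ κ' = κ.setLabel l₁) ∨
         (([1] : List A) ∈ f x ∧ κ' = κ.setLabel l₂))

/-- The successor relation on configurations. -/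
def Succ (M : GTM A k L X) (κ κ' : M.Config) : Prop :=
  ∃ h : κ.label ≠ M.final, M.Effect κ κ' (M.stm ⟨κ.label, h⟩)

/-- Finite non-empty and infinite sequences of configurations. -/
inductive ConfigSeq (M : GTM A k L X) where
  | finite (n : ℕ) (κ : Fin (n + 1) → M.Config)
  | infinite (κ : ℕ → M.Config)

/-- The first configuration of a sequence. -/
def ConfigSeq.first {M : GTM A k L X} : M.ConfigSeq → M.Config
  | .finite _ κ => κ 0
  | .infinite κ => κ 0

/-- A computation: each configuration is a successor of the preceding one. -/
def ConfigSeq.IsComputation {M : GTM A k L X} : M.ConfigSeq → Prop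
  | .finite n κ => ∀ i : Fin n, M.Succ (κ i.castSucc) (κ i.succ)
  | .infinite κ => ∀ i : ℕ, M.Succ (κ i) (κ (i + 1))

/-- Maximal: infinite, or the last configuration has no successor. -/
def ConfigSeq.IsMaximal {M : GTM A k L X} : M.ConfigSeq → Prop
  | .finite n κ => ∀ κ' : M.Config, ¬ M.Succ (κ (Fin.last n)) κ'
  | .infinite _ => True

/-- A configuration is accepting if its label is final and cell `0` of tape `0` contains an
element of `X 0`. -/
def Config.IsAccepting {M : GTM A k L X} (κ : M.Config) : Prop :=
  κ.label = M.final ∧ ∃ x : X 0, κ.tape 0 0 = Sum.inl x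

/-- A sequence is accepting if it is finite and its last configuration is accepting. -/
def ConfigSeq.IsAccepting {M : GTM A k L X} : M.ConfigSeq → Prop
  | .finite n κ => (κ (Fin.last n)).IsAccepting
  | .infinite _ => False

/-- The initial configuration: initial label, all heads on position `0`, cell `0` of the `i`-th
input tape contains the `i`-th argument, and all other cells are blank. -/
def initialConfig (M : GTM A k L X) (x : ∀ i : Fin k, X (M.inputTape i)) : M.Config where
  label := M.initial
  tape := Fin.cases (fun _ => Sum.inr M.blank) (fun i j =>
    if h : i.val < k ∧ j = 0 then Sum.inl (x ⟨i.val, h.1⟩) else Sum.inr M.blank)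
  head := fun _ => 0

/-- The multi-function computed by the machine: `y` is a value at `x` if every maximal
computation on `x` is accepting and some accepting computation on `x` has the result `y`. -/
def multiFun (M : GTM A k L X) : MultiFun (∀ i : Fin k, X (M.inputTape i)) (X 0) := fun x =>
  {y | (∀ c : M.ConfigSeq, c.IsComputation → c.first = M.initialConfig x → c.IsMaximal →
          c.IsAccepting) ∧
       ∃ (n : ℕ) (κ : Fin (n + 1) → M.Config),
          (ConfigSeq.finite n κ).IsComputation ∧ κ 0 = M.initialConfig x ∧
          (κ (Fin.last n)).IsAccepting ∧ (κ (Fin.last n)).tape 0 0 = Sum.inl y}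

end GTM

/-! ## Machines on infinite sequences -/

/-- The function that occurs in the statement, if there is one, is a (single-valued, partial)
continuous function. -/
def Stmt.IsContinuous {A : Type u} [Zero A] [One A] {L : ℕ} {Γ Lab : Type} :
    Stmt A (fun _ : Fin (L + 1) => OmegaWord A) Γ Lab → Prop
  | .assign _ n _ f _ =>
      ∃ g : (Fin n → OmegaWord A) →. OmegaWord A, f = MultiFun.ofPFun g ∧ PFunContinuous g
  | .test n _ f _ _ _ => PFunContinuous (X := Fin n → OmegaWord A) f
  | _ => True

/-- The function that occurs in the statement, if there is one, is a (single-valued, partial)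
computable function. -/
def Stmt.IsComputable {A : Type u} [Zero A] [One A] {L : ℕ} {Γ Lab : Type} :
    Stmt A (fun _ : Fin (L + 1) => OmegaWord A) Γ Lab → Prop
  | .assign _ n _ f _ =>
      ∃ g : (Fin n → OmegaWord A) →. OmegaWord A, f = MultiFun.ofPFun g ∧ ComputableSeq g
  | .test n _ f _ _ _ => ComputableWord (k := n) f
  | _ => True

end TTE

/-! A value in `OmegaWord A` is determined by finite pieces of information, and an accepting
computation uses only finitely many of them. The proof therefore runs `N` on finite words in place
of sequences.

The central notion is an approximation `Φ t w` of a multi-function `F`: if the words `w` are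
prefixes of the arguments, then `Φ t w` is a prefix of every value, and it becomes arbitrarily long
as `t` and `w` grow. Such an `F` is single-valued (`SeqApprox.unique`), and its partial function is
continuous (`SeqApprox.continuous`). Conversely, every continuous partial function has an
approximation (`exists_seqApprox_of_continuous`, `exists_wordApprox_of_continuous`). Computability
corresponds in the same way to primitive recursive approximations: a Type-2 machine is approximated
by running it for `t` steps on prefixes (`seqApprox_spec`, `wordApprox_spec`), and a primitive
recursive approximation is realised by a Type-2 machine that reads ever longer prefixes and writes
one more symbol whenever it is available (`SeqApprox.computable`).

It remains to see that approximations pass from the statements of `N` to `N.multiFun`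
(`exists_seqApprox_multiFun`). In a symbolic configuration labels, heads and work symbols are exact,
and sequences are replaced by prefixes. An assignment writes the prefix that is known; a test whose
outcome is unknown stalls. The symbolic run thus never leaves a given accepting computation. Since
that computation is finite, a required length of the result can be pulled back through its steps to
a required length of the inputs. The parameter `comp` treats both parts at once: it is `False` for
continuity and `True` for computability, where primitive recursiveness is carried along.

The realisation by a Type-2 machine compiles a primitive recursive transition function to a
`ToPartrec.Code`, then to the four-stack machine of `Turing.PartrecToTM2`, and keeps each stack on a
work tape. -/

/-! ## Primitive recursive functions on finite types, function spaces and integers -/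

namespace Primrec

variable {α β σ : Type*} [Primcodable α] [Primcodable β] [Primcodable σ]

/-- A family of primitive recursive functions over a finite type is primitive recursive. -/
theorem finite_uncurry [Finite α] {f : α → β → σ} (h : ∀ a, Primrec (f a)) : Primrec₂ f := by
  obtain ⟨n, ⟨e⟩⟩ := Finite.exists_equiv_fin α
  have h1 : Primrec₂ (fun (i : Fin n) (b : β) => f (e.symm i) b) :=
    Primrec.fin_curry₁.2 fun i => h _
  have h2 : Primrec e := Primrec.dom_finite e
  exact (h1.comp (h2.comp Primrec.fst) Primrec.snd).of_eq fun x => by simp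

theorem pi_mk {n : ℕ} {f : β → Fin n → σ} (h : ∀ j, Primrec fun b => f b j) : Primrec f :=
  Primrec.fin_curry.2 (Primrec₂.swap (finite_uncurry (f := fun j b => f b j) h))

theorem pi_apply {n : ℕ} {f : β → Fin n → σ} (h : Primrec f) (j : Fin n) :
    Primrec fun b => f b j :=
  (Primrec.fin_app.comp h (Primrec.const j) :)

theorem pi_update {n : ℕ} {f : β → Fin n → σ} {g : β → σ} (hf : Primrec f) (hg : Primrec g)
    (i : Fin n) : Primrec fun b => Function.update (f b) i (g b) := by
  refine pi_mk fun j => ?_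
  by_cases h : j = i
  · subst h; simpa using hg
  · simpa [h] using pi_apply hf j

theorem int_of_encode {f : ℤ → ℤ} {g : ℕ → ℕ} (hg : Primrec g)
    (h : ∀ z, Encodable.encode (f z) = g (Encodable.encode z)) : Primrec f :=
  Primrec.encode_iff.1 ((hg.comp Primrec.encode).of_eq fun z => (h z).symm)

theorem int_encode_ofNat (n : ℕ) : Encodable.encode (n : ℤ) = 2 * n := by
  rfl

theorem int_encode_negSucc (n : ℕ) : Encodable.encode (Int.negSucc n) = 2 * n + 1 := by
  rfl

theorem int_add_one : Primrec fun z : ℤ => z + 1 := by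
  -- Even codes belong to the nonnegative integers and odd codes to the negative ones, so the
  -- successor raises even codes by 2 and lowers odd codes by 2. The exception is `-1`, with code 1,
  -- which goes to `0`, with code 0.
  have hg : Primrec fun n : ℕ => if n % 2 = 0 then n + 2 else if n = 1 then 0 else n - 2 := by
    refine Primrec.ite (Primrec.eq.comp (Primrec.nat_mod.comp Primrec.id (Primrec.const 2))
      (Primrec.const 0)) (Primrec.nat_add.comp Primrec.id (Primrec.const 2)) ?_
    exact Primrec.ite (Primrec.eq.comp Primrec.id (Primrec.const 1)) (Primrec.const 0)
      (Primrec.nat_sub.comp Primrec.id (Primrec.const 2))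
  refine int_of_encode hg fun z => ?_
  cases z with
  | ofNat n =>
    have : (Int.ofNat n + 1 : ℤ) = ((n + 1 : ℕ) : ℤ) := by simp
    rw [this, int_encode_ofNat]
    change _ = if (2 * n) % 2 = 0 then _ else _
    rw [if_pos (by omega)]
    change _ = 2 * n + 2
    omega
  | negSucc n =>
    rw [int_encode_negSucc, if_neg (by omega)]
    cases n with
    | zero => rfl
    | succ n =>
      have : (Int.negSucc (n + 1) + 1 : ℤ) = Int.negSucc n := by omega
      rw [this, int_encode_negSucc, if_neg (by omega)]
      omega

theorem int_sub_one : Primrec fun z : ℤ => z - 1 := by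
  have hg : Primrec fun n : ℕ => if n % 2 = 1 then n + 2 else if n = 0 then 1 else n - 2 := by
    refine Primrec.ite (Primrec.eq.comp (Primrec.nat_mod.comp Primrec.id (Primrec.const 2))
      (Primrec.const 1)) (Primrec.nat_add.comp Primrec.id (Primrec.const 2)) ?_
    exact Primrec.ite (Primrec.eq.comp Primrec.id (Primrec.const 0)) (Primrec.const 1)
      (Primrec.nat_sub.comp Primrec.id (Primrec.const 2))
  refine int_of_encode hg fun z => ?_
  cases z with
  | ofNat n =>
    cases n with
    | zero => rfl
    | succ n =>
      have : (Int.ofNat (n + 1) - 1 : ℤ) = (n : ℤ) := by simp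
      rw [this, int_encode_ofNat]
      change _ = if (2 * (n + 1)) % 2 = 1 then _ else if 2 * (n + 1) = 0 then _ else 2 * (n + 1) - 2
      rw [if_neg (by omega), if_neg (by omega)]
      omega
  | negSucc n =>
    have : (Int.negSucc n - 1 : ℤ) = Int.negSucc (n + 1) := by omega
    rw [this, int_encode_negSucc, int_encode_negSucc, if_pos (by omega)]
    omega

end Primrec

/-- Some primitive recursive coding of a finite type. -/
noncomputable abbrev Primcodable.ofFinite (α : Type*) [Finite α] : Primcodable α :=
  Primcodable.ofEquiv (Fin (Nat.card α)) (Finite.equivFin α)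

namespace TTE

universe u v

/-! ## Tapes given by the position of the head and the list of all writing operations -/

/-- A tape, given by the position of the head and the writing operations, the last one first. -/
abbrev LogTape (C : Type*) := ℤ × List (ℤ × C)

namespace LogTape

variable {C : Type*}

/-- The content of cell `z`; the content is `d` if nothing has been written there. -/
def read (d : C) (T : LogTape C) (z : ℤ) : C := (T.2.lookup z).getD d

/-- Write on the scanned cell. -/
def write (x : C) (T : LogTape C) : LogTape C := (T.1, (T.1, x) :: T.2)

/-- Move the head. -/
def move : Option Turing.Dir → LogTape C → LogTape C
  | none, T => T
  | some Turing.Dir.left, T => (T.1 - 1, T.2)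
  | some Turing.Dir.right, T => (T.1 + 1, T.2)

theorem read_write (d x : C) (T : LogTape C) (z : ℤ) :
    (T.write x).read d z = if z = T.1 then x else T.read d z := by
  unfold read write
  by_cases h : z = T.1
  · simp [h]
  · simp [h, List.lookup_cons, beq_eq_false_iff_ne.2 h]

@[simp] theorem read_move (d : C) (m : Option Turing.Dir) (T : LogTape C) :
    (T.move m).read d = T.read d := by
  rcases m with _ | _ | _ <;> rfl

variable [Primcodable C] {β : Type*} [Primcodable β]

/-- This is the purpose of the log: a tape becomes a finite object of a `Primcodable` type, and
reading is a list lookup that finds the latest write first. -/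
theorem primrec_read (d : C) : Primrec₂ (read d) :=
  Primrec.option_getD.comp (Primrec.listLookup.comp Primrec.snd
    (Primrec.snd.comp Primrec.fst)) (Primrec.const d)

theorem primrec_write : Primrec₂ (write (C := C)) :=
  Primrec.pair (Primrec.fst.comp Primrec.snd) (Primrec.list_cons.comp
    (Primrec.pair (Primrec.fst.comp Primrec.snd) Primrec.fst) (Primrec.snd.comp Primrec.snd))

theorem primrec_move (m : Option Turing.Dir) : Primrec (move (C := C) m) := by
  rcases m with _ | _ | _
  · exact Primrec.id
  · exact Primrec.pair (Primrec.int_sub_one.comp Primrec.fst) Primrec.snd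
  · exact Primrec.pair (Primrec.int_add_one.comp Primrec.fst) Primrec.snd

end LogTape

/-! ## Approximations by finite words -/

/-- `w` is a prefix of `p`. -/
def IsPrefix {A : Type u} (w : List A) (p : OmegaWord A) : Prop :=
  ∀ (i : ℕ) (c : A), w[i]? = some c → c = p i

/-- From the time `t` and prefixes of the arguments, `Φ` finds a prefix of the value of `F`,
and these prefixes become arbitrarily long. -/
structure SeqApprox {A : Type u} {m : ℕ} (F : MultiFun (Fin m → OmegaWord A) (OmegaWord A))
    (Φ : ℕ → (Fin m → List A) → List A) : Prop where
  sound : ∀ p, ∀ q ∈ F p, ∀ t w, (∀ i, IsPrefix (w i) (p i)) → IsPrefix (Φ t w) q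
  complete : ∀ p, ∀ q ∈ F p, ∀ j, ∃ n, ∀ t ≥ n, ∀ w : Fin m → List A,
    (∀ i, IsPrefix (w i) (p i)) → (∀ i, n ≤ (w i).length) → j ≤ (Φ t w).length

/-- From the time `t` and prefixes of the arguments, `Ψ` finds the value of `f`, provided the
time and the prefixes are long enough. -/
structure WordApprox {A : Type u} {m : ℕ} (f : (Fin m → OmegaWord A) →. FinWord A)
    (Ψ : ℕ → (Fin m → List A) → Option (List A)) : Prop where
  sound : ∀ p, ∀ v ∈ f p, ∀ t w, (∀ i, IsPrefix (w i) (p i)) → ∀ u, Ψ t w = some u → u = v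
  complete : ∀ p, ∀ v ∈ f p, ∃ n, ∀ t ≥ n, ∀ w : Fin m → List A,
    (∀ i, IsPrefix (w i) (p i)) → (∀ i, n ≤ (w i).length) → (Ψ t w).isSome

/-! ## Generalized Turing machines on finite prefixes -/

section Symbolic

variable {A : Type u} {Γ Lab : Type} {L : ℕ}

/-- A configuration in which the sequences are replaced by finite words. -/
abbrev SymConfig (A : Type u) (L : ℕ) (Γ Lab : Type) :=
  Lab × (Fin (L + 1) → LogTape (List A ⊕ Γ))

/-- The first content is a prefix, of length at least `n`, of the second content. -/
def CellRel (n : ℕ) : List A ⊕ Γ → OmegaWord A ⊕ Γ → Prop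
  | .inl w, .inl p => IsPrefix w p ∧ n ≤ w.length
  | .inr a, .inr b => a = b
  | _, _ => False

theorem CellRel.mono {n n' : ℕ} (h : n' ≤ n) {x : List A ⊕ Γ} {y : OmegaWord A ⊕ Γ}
    (hx : CellRel n x y) : CellRel n' x y := by
  cases x <;> cases y <;> simp only [CellRel] at hx ⊢
  · exact ⟨hx.1, h.trans hx.2⟩
  · exact hx

/-- The word in a cell; the empty word if the cell contains a work symbol. -/
def cellWord (x : List A ⊕ Γ) : List A := x.elim id fun _ => []

theorem CellRel.inl {n : ℕ} {w : List A} {p : OmegaWord A} (h : IsPrefix w p)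
    (hn : n ≤ w.length) : CellRel (Γ := Γ) n (Sum.inl w) (Sum.inl p) :=
  ⟨h, hn⟩

theorem CellRel.cellWord {n : ℕ} {x : List A ⊕ Γ} {p : OmegaWord A}
    (h : CellRel n x (Sum.inl p)) : IsPrefix (cellWord x) p ∧ n ≤ (TTE.cellWord x).length := by
  cases x with
  | inl w => exact h
  | inr a => exact h.elim

/-- Work symbols are represented exactly, so `ifSymbol` is decided correctly however short the words
are. -/
theorem CellRel.inr_iff {n : ℕ} {x : List A ⊕ Γ} {y : OmegaWord A ⊕ Γ} (h : CellRel n x y)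
    (a : Γ) : x = Sum.inr a ↔ y = Sum.inr a := by
  cases x <;> cases y <;> simp only [CellRel] at h <;> simp [h]

theorem primrec_cellWord [Primcodable A] [Primcodable Γ] :
    Primrec (cellWord : List A ⊕ Γ → List A) :=
  (Primrec.sumCasesOn Primrec.id Primrec.snd.to₂ (Primrec.const []).to₂).of_eq fun x => by
    cases x <;> rfl

variable [Zero A] [One A] {k : ℕ} {N : GTM A k L (fun _ => OmegaWord A)}

/-- The symbolic configuration `c` approximates `κ` by words of length at least `n`. -/
def ConfigRel (n : ℕ) (c : SymConfig A L N.Γ N.Label) (κ : N.Config) : Prop :=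
  c.1 = κ.label ∧ ∀ i, (c.2 i).1 = κ.head i ∧
    ∀ z, CellRel n ((c.2 i).read (Sum.inr N.blank) z) (κ.tape i z)

theorem ConfigRel.mono {n n' : ℕ} (h : n' ≤ n) {c : SymConfig A L N.Γ N.Label} {κ : N.Config}
    (hc : ConfigRel n c κ) : ConfigRel n' c κ :=
  ⟨hc.1, fun i => ⟨(hc.2 i).1, fun z => ((hc.2 i).2 z).mono h⟩⟩

/-- The content of the scanned cell. -/
def symScanned (b : Γ) (c : SymConfig A L Γ Lab) (i : Fin (L + 1)) : List A ⊕ Γ :=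
  (c.2 i).read (Sum.inr b) (c.2 i).1

theorem ConfigRel.scanned {n : ℕ} {c : SymConfig A L N.Γ N.Label} {κ : N.Config}
    (h : ConfigRel n c κ) (i : Fin (L + 1)) :
    CellRel n (symScanned N.blank c i) (κ.scanned i) := by
  have := (h.2 i).2 (c.2 i).1
  rw [GTM.Config.scanned, ← (h.2 i).1]
  exact this

theorem ConfigRel.setLabel {n : ℕ} {c : SymConfig A L N.Γ N.Label} {κ : N.Config}
    (h : ConfigRel n c κ) (l : N.Label) : ConfigRel n (l, c.2) (κ.setLabel l) :=
  ⟨rfl, h.2⟩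

theorem ConfigRel.setHead {n : ℕ} {c : SymConfig A L N.Γ N.Label} {κ : N.Config}
    (h : ConfigRel n c κ) (i : Fin (L + 1)) (m : Option Turing.Dir) {z : ℤ}
    (hz : ((c.2 i).move m).1 = z) :
    ConfigRel n (c.1, Function.update c.2 i ((c.2 i).move m)) (κ.setHead i z) := by
  refine ⟨h.1, fun j => ?_⟩
  by_cases hj : j = i
  · subst hj
    simpa [GTM.Config.setHead, hz] using (h.2 j).2
  · simpa [GTM.Config.setHead, hj] using h.2 j

theorem ConfigRel.setCell {n : ℕ} {c : SymConfig A L N.Γ N.Label} {κ : N.Config}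
    (h : ConfigRel n c κ) (i : Fin (L + 1)) {x : List A ⊕ N.Γ} {y : OmegaWord A ⊕ N.Γ}
    (hxy : CellRel n x y) :
    ConfigRel n (c.1, Function.update c.2 i ((c.2 i).write x)) (κ.setCell i y) := by
  refine ⟨h.1, fun j => ?_⟩
  by_cases hj : j = i
  · subst hj
    refine ⟨by simpa [GTM.Config.setCell, LogTape.write] using (h.2 j).1, fun z => ?_⟩
    simp only [GTM.Config.setCell, Function.update_self, LogTape.read_write, (h.2 j).1]
    by_cases hz : z = κ.head j
    · subst hz; simpa using hxy
    · simpa [hz] using (h.2 j).2 z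
  · simpa [GTM.Config.setCell, hj] using h.2 j

/-- `e t` performs the effect of the statement `s` on symbolic configurations, or does nothing if
the information is insufficient. -/
structure SymEffect (N : GTM A k L (fun _ => OmegaWord A))
    (s : Stmt A (fun _ : Fin (L + 1) => OmegaWord A) N.Γ N.Label)
    (e : ℕ → SymConfig A L N.Γ N.Label → SymConfig A L N.Γ N.Label) : Prop where
  sound : ∀ t c κ κ', ConfigRel 0 c κ → N.Effect κ κ' s → e t c = c ∨ ConfigRel 0 (e t c) κ'
  complete : ∀ κ κ₁, N.Effect κ κ₁ s → ∀ j, ∃ n, ∀ t ≥ n, ∀ c, ConfigRel n c κ →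
    ConfigRel j (e t c) κ₁

/-- An effect that needs no information on the words. -/
theorem SymEffect.of_exact {s : Stmt A (fun _ : Fin (L + 1) => OmegaWord A) N.Γ N.Label}
    {e : SymConfig A L N.Γ N.Label → SymConfig A L N.Γ N.Label}
    (h : ∀ n c κ κ', ConfigRel n c κ → N.Effect κ κ' s → ConfigRel n (e c) κ') :
    SymEffect N s fun _ => e :=
  ⟨fun _ c κ κ' hc he => Or.inr (h 0 c κ κ' hc he),
    fun κ κ' he j => ⟨j, fun _ _ c hc => h j c κ κ' hc he⟩⟩

/-- The function in the statement, if there is one, has an approximation, which is primitive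
recursive if `comp` holds. -/
def Stmt.HasApprox [Primcodable A] (comp : Prop) {Γ Lab : Type} :
    Stmt A (fun _ : Fin (L + 1) => OmegaWord A) Γ Lab → Prop
  | .assign _ n _ f _ => ∃ Φ, SeqApprox (m := n) f Φ ∧
      (comp → Primrec fun x : ℕ × (Fin n → List A) => Φ x.1 x.2)
  | .test n _ f _ _ _ => ∃ Ψ, WordApprox (m := n) f Ψ ∧
      (comp → Primrec fun x : ℕ × (Fin n → List A) => Ψ x.1 x.2)
  | _ => True

/-- The condition on all maximal computations only restricts the domain. Approximations demand
nothing outside the domain, so one run to the result suffices. -/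
theorem exists_of_mem_multiFun {p : Fin k → OmegaWord A} {q : OmegaWord A}
    (h : q ∈ N.multiFun p) : ∃ κ : N.Config,
      Relation.ReflTransGen N.Succ (N.initialConfig p) κ ∧ κ.label = N.final ∧
      κ.tape 0 0 = Sum.inl q := by
  obtain ⟨-, n, κ, hc, h0, ha, hq⟩ := h
  refine ⟨κ (Fin.last n), ?_, ha.1, hq⟩
  rw [← h0]
  have : ∀ i : Fin (n + 1), Relation.ReflTransGen N.Succ (κ 0) (κ i) := fun i => by
    induction i using Fin.induction with
    | zero => exact .refl
    | succ i ih => exact ih.tail (hc i)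
  exact this _

/-- The initial symbolic configuration for words on the input tapes. -/
def symInit (N : GTM A k L (fun _ => OmegaWord A)) (w : Fin k → List A) :
    SymConfig A L N.Γ N.Label :=
  (N.initial, fun i => (0, Fin.cases [] (fun i =>
    if h : i.val < k then [(0, Sum.inl (w ⟨i.val, h⟩))] else []) i))

theorem configRel_symInit {n : ℕ} {w : Fin k → List A} {p : Fin k → OmegaWord A}
    (h : ∀ i, IsPrefix (w i) (p i)) (hn : ∀ i, n ≤ (w i).length) :
    ConfigRel n (symInit N w) (N.initialConfig p) := by
  refine ⟨rfl, fun i => ⟨rfl, fun z => ?_⟩⟩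
  induction i using Fin.cases with
  | zero => simp [symInit, GTM.initialConfig, LogTape.read, CellRel]
  | succ i =>
    simp only [symInit, GTM.initialConfig, LogTape.read, Fin.cases_succ]
    by_cases hi : i.val < k
    · by_cases hz : z = 0
      · subst hz
        simpa [hi] using CellRel.inl (h _) (hn _)
      · simp [hi, hz, List.lookup_cons, beq_eq_false_iff_ne.2 hz, CellRel]
    · simp [hi, CellRel]

variable [Primcodable A] [Primcodable N.Γ] [Primcodable N.Label]

theorem primrec_symScanned {β : Type*} [Primcodable β] {f : β → SymConfig A L N.Γ N.Label}
    (hf : Primrec f) (i : Fin (L + 1)) : Primrec fun b => symScanned N.blank (f b) i :=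
  (LogTape.primrec_read _).comp (Primrec.pi_apply (Primrec.snd.comp hf) i)
    (Primrec.fst.comp (Primrec.pi_apply (Primrec.snd.comp hf) i))

-- Moves, symbol writes and symbol tests are exact. An assignment never waits, since even the empty
-- word is a correct prefix. A test decides the control flow, so it leaves the configuration
-- unchanged until `Ψ` gives an answer.
open Classical in
theorem exists_symEffect [NeZero (1 : A)] {comp : Prop}
    (s : Stmt A (fun _ : Fin (L + 1) => OmegaWord A) N.Γ N.Label) (hs : s.HasApprox comp) :
    ∃ e, SymEffect N s e ∧ (comp → Primrec₂ e) := by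
  have hsnd : Primrec fun x : ℕ × SymConfig A L N.Γ N.Label => x.2.2 :=
    Primrec.snd.comp Primrec.snd
  cases s with
  | right i l =>
    refine ⟨fun _ c => (l, Function.update c.2 i ((c.2 i).move (some .right))),
      .of_exact fun n c κ κ' hc he => ?_, fun _ => ?_⟩
    · subst he
      exact (hc.setHead i _ (by simp [LogTape.move, (hc.2 i).1])).setLabel l
    · exact Primrec.pair (Primrec.const l) (Primrec.pi_update hsnd
        ((LogTape.primrec_move _).comp (Primrec.pi_apply hsnd i)) i)
  | left i l =>
    refine ⟨fun _ c => (l, Function.update c.2 i ((c.2 i).move (some .left))),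
      .of_exact fun n c κ κ' hc he => ?_, fun _ => ?_⟩
    · subst he
      exact (hc.setHead i _ (by simp [LogTape.move, (hc.2 i).1])).setLabel l
    · exact Primrec.pair (Primrec.const l) (Primrec.pi_update hsnd
        ((LogTape.primrec_move _).comp (Primrec.pi_apply hsnd i)) i)
  | write i a l =>
    refine ⟨fun _ c => (l, Function.update c.2 i ((c.2 i).write (Sum.inr a))),
      .of_exact fun n c κ κ' hc he => ?_, fun _ => ?_⟩
    · subst he
      exact (hc.setCell i (by simp [CellRel])).setLabel l
    · exact Primrec.pair (Primrec.const l) (Primrec.pi_update hsnd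
        (LogTape.primrec_write.comp (Primrec.const _) (Primrec.pi_apply hsnd i)) i)
  | ifSymbol i a l₁ l₂ =>
    refine ⟨fun _ c => (if symScanned N.blank c i = Sum.inr a then l₁ else l₂, c.2),
      .of_exact fun n c κ κ' hc he => ?_, fun _ => ?_⟩
    · have := (hc.scanned i).inr_iff a
      rcases he with ⟨h1, rfl⟩ | ⟨h1, rfl⟩
      · simpa [this.2 h1] using hc.setLabel l₁
      · simpa [mt this.1 h1] using hc.setLabel l₂
    · exact Primrec.pair (Primrec.ite (Primrec.eq.comp (primrec_symScanned Primrec.snd i)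
        (Primrec.const _)) (Primrec.const _) (Primrec.const _)) hsnd
  | assign i m arg f l =>
    obtain ⟨Φ, hΦ, hp⟩ := hs
    refine ⟨fun t c => (l, Function.update c.2 i ((c.2 i).write (Sum.inl
      (Φ t fun j => cellWord (symScanned N.blank c (arg j)))))), ⟨?_, ?_⟩, fun hcomp => ?_⟩
    · rintro t c κ κ' hc ⟨x, hx, y, hy, rfl⟩
      refine Or.inr ((hc.setCell i (.inl (hΦ.sound x y hy t _ fun j => ?_)
        (Nat.zero_le _))).setLabel l)
      have := hc.scanned (arg j)
      rw [hx j] at this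
      exact this.cellWord.1
    · rintro κ κ' ⟨x, hx, y, hy, rfl⟩ j
      obtain ⟨n, hn⟩ := hΦ.complete x y hy j
      -- The bound `n` makes the new word long enough, and `j` does so for all the other cells.
      refine ⟨max n j, fun t ht c hc => ?_⟩
      have hw : ∀ j, IsPrefix (cellWord (symScanned N.blank c (arg j))) (x j) ∧
          max n _ ≤ (cellWord (symScanned N.blank c (arg j))).length := fun j => by
        have := hc.scanned (arg j)
        rw [hx j] at this
        exact this.cellWord
      exact ((hc.mono (le_max_right _ _)).setCell i (.inl
        (hΦ.sound x y hy t _ fun j => (hw j).1)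
        (hn t ((le_max_left _ _).trans ht) _ (fun j => (hw j).1)
          fun j => (le_max_left _ _).trans (hw j).2))).setLabel l
    · refine Primrec.pair (Primrec.const l) (Primrec.pi_update hsnd
        (LogTape.primrec_write.comp (Primrec.sumInl.comp ((hp hcomp).comp
          (Primrec.pair Primrec.fst (Primrec.pi_mk fun j => ?_)))) (Primrec.pi_apply hsnd i)) i)
      exact primrec_cellWord.comp (primrec_symScanned Primrec.snd (arg j))
  | test m arg f hf l₁ l₂ =>
    obtain ⟨Ψ, hΨ, hp⟩ := hs
    have h01 : ([0] : List A) ≠ [1] := by simp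
    set d : ℕ → SymConfig A L N.Γ N.Label → Option (List A) := fun t c =>
      Ψ t fun j => cellWord (symScanned N.blank c (arg j)) with hd
    refine ⟨fun t c => if d t c = some [0] then (l₁, c.2) else if d t c = some [1] then (l₂, c.2)
      else c, ⟨?_, ?_⟩, fun hcomp => ?_⟩
    · rintro t c κ κ' hc ⟨x, hx, hv⟩
      have hw : ∀ j, IsPrefix (cellWord (symScanned N.blank c (arg j))) (x j) := fun j => by
        have := hc.scanned (arg j)
        rw [hx j] at this
        exact this.cellWord.1
      rcases hv with ⟨hv, rfl⟩ | ⟨hv, rfl⟩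
      · cases h : d t c with
        | none => simp
        | some u =>
          cases hΨ.sound x _ hv t _ hw u h
          simpa using Or.inr (hc.setLabel l₁)
      · cases h : d t c with
        | none => simp
        | some u =>
          cases hΨ.sound x _ hv t _ hw u h
          simpa using Or.inr (hc.setLabel l₂)
    · rintro κ κ' ⟨x, hx, hv⟩ j
      have hw : ∀ n c, ConfigRel n c κ → ∀ j,
          IsPrefix (cellWord (symScanned N.blank c (arg j))) (x j) ∧
          n ≤ (cellWord (symScanned N.blank c (arg j))).length := fun n c hc j => by
        have := hc.scanned (arg j)
        rw [hx j] at this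
        exact this.cellWord
      have key : ∀ v : List A, v ∈ f x → ∃ n, ∀ t ≥ n, ∀ c, ConfigRel n c κ → d t c = some v := by
        intro v hv
        obtain ⟨n, hn⟩ := hΨ.complete x v hv
        refine ⟨n, fun t ht c hc => ?_⟩
        obtain ⟨u, hu⟩ := Option.isSome_iff_exists.1
          (hn t ht _ (fun j => (hw n c hc j).1) fun j => (hw n c hc j).2)
        rw [← hΨ.sound x v hv t _ (fun j => (hw n c hc j).1) u hu]
        exact hu
      rcases hv with ⟨hv, rfl⟩ | ⟨hv, rfl⟩
      · obtain ⟨n, hn⟩ := key _ hv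
        refine ⟨max n j, fun t ht c hc => ?_⟩
        have := hn t ((le_max_left _ _).trans ht) c (hc.mono (le_max_left _ _))
        rw [if_pos this]
        exact (hc.mono (le_max_right _ _)).setLabel l₁
      · obtain ⟨n, hn⟩ := key _ hv
        refine ⟨max n j, fun t ht c hc => ?_⟩
        have := hn t ((le_max_left _ _).trans ht) c (hc.mono (le_max_left _ _))
        rw [if_neg (by simp [this]), if_pos this]
        exact (hc.mono (le_max_right _ _)).setLabel l₂
    · have hdp : Primrec fun x : ℕ × SymConfig A L N.Γ N.Label => d x.1 x.2 :=
        (hp hcomp).comp (Primrec.pair Primrec.fst (Primrec.pi_mk fun j =>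
          primrec_cellWord.comp (primrec_symScanned Primrec.snd (arg j))))
      exact Primrec.ite (Primrec.eq.comp hdp (Primrec.const _))
        (Primrec.pair (Primrec.const _) hsnd)
        (Primrec.ite (Primrec.eq.comp hdp (Primrec.const _))
          (Primrec.pair (Primrec.const _) hsnd) Primrec.snd)

theorem primrec_symInit : Primrec (symInit N) := by
  refine Primrec.pair (Primrec.const _) (Primrec.pi_mk fun i => Primrec.pair (Primrec.const _) ?_)
  induction i using Fin.cases with
  | zero => exact Primrec.const _
  | succ i =>
    by_cases hi : i.val < k
    · simp only [Fin.cases_succ, hi, dif_pos]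
      exact Primrec.list_cons.comp (Primrec.pair (Primrec.const _)
        (Primrec.sumInl.comp (Primrec.pi_apply Primrec.id _))) (Primrec.const _)
    · simp only [Fin.cases_succ, hi, dif_neg, not_false_eq_true]
      exact Primrec.const _

/-- The word in cell `0` of tape `0` if the final label has been reached. -/
noncomputable def symResult (N : GTM A k L (fun _ => OmegaWord A))
    (c : SymConfig A L N.Γ N.Label) : List A :=
  open Classical in
  if c.1 = N.final then cellWord ((c.2 0).read (Sum.inr N.blank) 0) else []

theorem primrec_symResult : Primrec (symResult N) := by
  classical
  exact Primrec.ite (Primrec.eq.comp Primrec.fst (Primrec.const _))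
    (primrec_cellWord.comp ((LogTape.primrec_read _).comp
      (Primrec.pi_apply Primrec.snd 0) (Primrec.const 0))) (Primrec.const [])

/-- The function computed by a generalized Turing machine can be approximated if the functions
that occur in its statements can be approximated. -/
theorem exists_seqApprox_multiFun [NeZero (1 : A)] {comp : Prop}
    (hN : ∀ l, (N.stm l).HasApprox comp) :
    ∃ Φ, SeqApprox (m := k) N.multiFun Φ ∧
      (comp → Primrec fun x : ℕ × (Fin k → List A) => Φ x.1 x.2) := by
  classical
  choose e he hp using fun l => exists_symEffect (N.stm l) (hN l)
  -- Final configurations become fixed points, so a result persists when the run continues beyond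
  -- acceptance.
  let E : N.Label → ℕ → SymConfig A L N.Γ N.Label → SymConfig A L N.Γ N.Label := fun l =>
    if h : l = N.final then fun _ => id else e ⟨l, h⟩
  have hEf : E N.final = fun _ => id := by simp [E]
  have hE : ∀ l (h : l ≠ N.final), E l = e ⟨l, h⟩ := fun l h => by simp [E, h]
  let step : ℕ → SymConfig A L N.Γ N.Label → SymConfig A L N.Γ N.Label := fun t c => E c.1 t c
  have hfix : ∀ t c, c.1 = N.final → ∀ r, (step t)^[r] c = c := fun t c hc r =>
    Function.iterate_fixed (by simp [step, hc, hEf]) r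
  -- The parameter `t` is both the number of symbolic steps and the time granted to every function
  -- call.
  refine ⟨fun t w => symResult N ((step t)^[t] (symInit N w)), ⟨?_, ?_⟩, fun hcomp => ?_⟩
  · intro p q hq t w hw
    obtain ⟨κ, hκ, hl, hq⟩ := exists_of_mem_multiFun hq
    -- The invariant follows the given computation to `κ`: each symbolic configuration approximates
    -- one from which `κ` is still reachable. A stalled step keeps `κ'`, any other step advances to
    -- its successor on the path.
    have key : ∀ r, ∃ κ', ConfigRel 0 ((step t)^[r] (symInit N w)) κ' ∧
        Relation.ReflTransGen N.Succ κ' κ := by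
      intro r
      induction r with
      | zero => exact ⟨_, configRel_symInit hw fun _ => Nat.zero_le _, hκ⟩
      | succ r ih =>
        obtain ⟨κ', hr, hκ'⟩ := ih
        rw [Function.iterate_succ_apply']
        rcases hκ'.cases_head with rfl | ⟨κ₁, ⟨hne, hs⟩, h2⟩
        · exact ⟨_, by simpa [step, hr.1.trans hl, hEf] using hr, .refl⟩
        · have hne' := hr.1 ▸ hne
          have hl' : (⟨_, hne'⟩ : {l // l ≠ N.final}) = ⟨κ'.label, hne⟩ := Subtype.ext hr.1
          simp only [step, hE _ hne', hl']
          rcases (he ⟨κ'.label, hne⟩).sound t _ κ' κ₁ hr hs with h | h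
          · exact ⟨κ', by rw [h]; exact hr, hκ'⟩
          · exact ⟨κ₁, h, h2⟩
    obtain ⟨κ', hr, hκ'⟩ := key t
    unfold symResult
    split_ifs with hf
    -- A configuration with the final label has no successor, so here `κ'` must be `κ` itself.
    · rcases hκ'.cases_head with rfl | ⟨κ₁, ⟨hne, hs⟩, h2⟩
      · have := (hr.2 0).2 0
        rw [hq] at this
        exact this.cellWord.1
      · exact absurd (hr.1 ▸ hf) hne
    · intro i c h
      simp at h
  · intro p q hq
    obtain ⟨κ, hκ, hl, hq⟩ := exists_of_mem_multiFun hq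
    -- The order of quantifiers matters: `r` is the length of the computation and does not depend on
    -- `j`. Only the bound `n` on time and input lengths does, and it is pulled back one step at a
    -- time.
    have key : ∃ r, ∀ j, ∃ n, ∀ t ≥ n, ∀ w : Fin k → List A, (∀ i, IsPrefix (w i) (p i)) →
        (∀ i, n ≤ (w i).length) → ConfigRel j ((step t)^[r] (symInit N w)) κ := by
      clear hl hq
      induction hκ with
      | refl => exact ⟨0, fun j => ⟨j, fun t _ w hw hn => configRel_symInit hw hn⟩⟩
      | @tail κ' κ₁ _ hs ih =>
        obtain ⟨hne, hs⟩ := hs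
        obtain ⟨r, hr⟩ := ih
        refine ⟨r + 1, fun j => ?_⟩
        obtain ⟨n₁, hn₁⟩ := (he ⟨κ'.label, hne⟩).complete _ _ hs j
        obtain ⟨n, hn⟩ := hr n₁
        refine ⟨max n n₁, fun t ht w hw hw' => ?_⟩
        have h1 := hn t ((le_max_left _ _).trans ht) w hw fun i => (le_max_left _ _).trans (hw' i)
        rw [Function.iterate_succ_apply']
        have hne' := h1.1 ▸ hne
        have hl' : (⟨_, hne'⟩ : {l // l ≠ N.final}) = ⟨κ'.label, hne⟩ := Subtype.ext h1.1
        simp only [step, hE _ hne', hl']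
        exact hn₁ t ((le_max_right _ _).trans ht) _ h1
    obtain ⟨r, hr⟩ := key
    intro j
    obtain ⟨n, hn⟩ := hr j
    refine ⟨max n r, fun t ht w hw hw' => ?_⟩
    have h1 := hn t ((le_max_left _ _).trans ht) w hw fun i => (le_max_left _ _).trans (hw' i)
    have hf := h1.1.trans hl
    obtain ⟨s, hs⟩ := Nat.exists_eq_add_of_le' ((le_max_right n r).trans ht)
    have h2 : (step t)^[t] (symInit N w) = (step t)^[r] (symInit N w) := by
      rw [← hfix t _ hf s, ← Function.iterate_add_apply, ← hs]
    rw [h2, symResult, if_pos hf]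
    have := (h1.2 0).2 0
    rw [hq] at this
    exact this.cellWord.2
  · have hEp : ∀ l, Primrec fun x : ℕ × SymConfig A L N.Γ N.Label => E l x.1 x.2 := fun l => by
      by_cases h : l = N.final
      · subst h; rw [hEf]; exact Primrec.snd
      · rw [hE l h]; exact hp _ hcomp
    have hstep : Primrec₂ step := (Primrec.finite_uncurry hEp).comp
      (Primrec.fst.comp Primrec.snd) Primrec.id
    exact primrec_symResult.comp (Primrec.nat_iterate Primrec.fst
      (primrec_symInit.comp Primrec.snd) (hstep.comp (Primrec.fst.comp Primrec.fst)
        Primrec.snd).to₂)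

end Symbolic

open Filter Topology

/-! ## Continuous functions and approximations -/

section Continuity

variable {A : Type u} {k : ℕ}

/-- The prefix of length `n`. -/
def OmegaWord.take (p : OmegaWord A) (n : ℕ) : List A :=
  (List.range n).map fun i => p i

@[simp] theorem OmegaWord.length_take (p : OmegaWord A) (n : ℕ) : (p.take n).length = n := by
  simp [OmegaWord.take]

theorem OmegaWord.getElem?_take (p : OmegaWord A) {n i : ℕ} (h : i < n) :
    (p.take n)[i]? = some (p i) := by
  simp [OmegaWord.take, h]

theorem OmegaWord.isPrefix_take {p p' : OmegaWord A} {n : ℕ} (h : ∀ i < n, p' i = p i) :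
    IsPrefix (p'.take n) p := by
  intro i c hc
  have hi : i < n := by simpa using (List.getElem?_eq_some_iff.1 hc).1
  rw [p'.getElem?_take hi] at hc
  rw [← h i hi]
  exact (Option.some.inj hc).symm

theorem IsPrefix.take_self (p : OmegaWord A) (n : ℕ) : IsPrefix (p.take n) p :=
  OmegaWord.isPrefix_take fun _ _ => rfl

theorem IsPrefix.getElem?_eq {w : List A} {p : OmegaWord A} (h : IsPrefix w p) {i : ℕ}
    (hi : i < w.length) : w[i]? = some (p i) := by
  rw [List.getElem?_eq_getElem hi, h i _ (List.getElem?_eq_getElem hi)]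

theorem IsPrefix.eq_of_isPrefix {w : List A} {p q : OmegaWord A} (h : IsPrefix w p)
    (h' : IsPrefix w q) {i : ℕ} (hi : i < w.length) : p i = q i :=
  Option.some.inj ((h.getElem?_eq hi).symm.trans (h'.getElem?_eq hi))

theorem eventually_agree (p : Fin k → OmegaWord A) (n : ℕ) :
    ∀ᶠ p' in 𝓝 p, ∀ i, ∀ m < n, p' i m = p i m := by
  -- The topology of `OmegaWord A` is the product topology for this choice on `A`.
  let : TopologicalSpace A := ⊥
  have : DiscreteTopology A := ⟨rfl⟩
  refine eventually_all.2 fun i => (Set.finite_lt_nat n).eventually_all.2 fun m _ => ?_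
  have h : Continuous fun p' : Fin k → OmegaWord A => p' i m :=
    (continuous_apply (A := fun _ : ℕ => A) m).comp
      (continuous_apply (A := fun _ : Fin k => OmegaWord A) i)
  exact h.continuousAt.eventually (p := fun a => a = p i m) (by simp [nhds_discrete])

/-- Otherwise there is, for each `n`, a counterexample that agrees with `p` below `n`, and these
counterexamples converge to `p`. -/
theorem exists_of_eventually {p : Fin k → OmegaWord A} {P : (Fin k → OmegaWord A) → Prop}
    (h : ∀ᶠ p' in 𝓝 p, P p') : ∃ n, ∀ p', (∀ i, ∀ m < n, p' i m = p i m) → P p' := by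
  by_contra! hc
  choose s hs hP using hc
  have ht : Tendsto s atTop (𝓝 p) := by
    let : TopologicalSpace A := ⊥
    have : DiscreteTopology A := ⟨rfl⟩
    refine tendsto_pi_nhds.2 fun i => (tendsto_pi_nhds (A := fun _ : ℕ => A)).2 fun m => ?_
    refine tendsto_const_nhds.congr' ?_
    filter_upwards [eventually_gt_atTop m] with n hn using (hs n i m hn).symm
  obtain ⟨n, hn⟩ := (ht.eventually h).exists
  exact hP n hn

/-- Soundness makes the same word a prefix of both values, and completeness makes that word as long
as desired. -/
theorem SeqApprox.unique {F : MultiFun (Fin k → OmegaWord A) (OmegaWord A)}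
    {Φ : ℕ → (Fin k → List A) → List A} (h : SeqApprox F Φ) {p : Fin k → OmegaWord A}
    {q q' : OmegaWord A} (hq : q ∈ F p) (hq' : q' ∈ F p) : q = q' := by
  funext j
  obtain ⟨n, hn⟩ := h.complete p q hq (j + 1)
  have hw : ∀ i, IsPrefix ((p i).take n) (p i) := fun i => .take_self _ _
  exact (h.sound p q hq n _ hw).eq_of_isPrefix (h.sound p q' hq' n _ hw)
    (hn n le_rfl _ hw fun i => (OmegaWord.length_take _ _).ge)

theorem MultiFun.exists_eq_ofPFun {X : Type u} {Y : Type v} {F : MultiFun X Y}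
    (h : ∀ x, ∀ y ∈ F x, ∀ y' ∈ F x, y = y') : ∃ g : X →. Y, F = MultiFun.ofPFun g := by
  refine ⟨fun x => ⟨∃ y, y ∈ F x, fun hx => hx.choose⟩, funext fun x => Set.ext fun y => ?_⟩
  refine ⟨fun hy => ⟨⟨y, hy⟩, h x _ (Exists.choose_spec (⟨y, hy⟩ : ∃ y, y ∈ F x)) _ hy⟩, ?_⟩
  rintro ⟨hx, rfl⟩
  exact hx.choose_spec

theorem SeqApprox.exists_eq_ofPFun {F : MultiFun (Fin k → OmegaWord A) (OmegaWord A)}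
    {Φ : ℕ → (Fin k → List A) → List A} (h : SeqApprox F Φ) :
    ∃ g : (Fin k → OmegaWord A) →. OmegaWord A, F = MultiFun.ofPFun g :=
  MultiFun.exists_eq_ofPFun fun _ _ hq _ hq' => h.unique hq hq'

/-- The first `n` symbols of the arguments already fix the `j`-th symbol of the value, because one
word `Φ n w` is a prefix of the values at all domain points extending `w`. Each coordinate is
therefore locally constant on the domain. -/
theorem SeqApprox.continuous {g : (Fin k → OmegaWord A) →. OmegaWord A}
    {Φ : ℕ → (Fin k → List A) → List A} (h : SeqApprox (MultiFun.ofPFun g) Φ) :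
    PFunContinuous g := by
  let : TopologicalSpace A := ⊥
  have : DiscreteTopology A := ⟨rfl⟩
  refine (continuous_pi_iff (A := fun _ : ℕ => A)).2 fun j => ?_
  refine IsLocallyConstant.continuous (IsLocallyConstant.iff_eventually_eq _ |>.2 fun x => ?_)
  obtain ⟨n, hn⟩ := h.complete x.1 (g.fn x.1 x.2) ⟨x.2, rfl⟩ (j + 1)
  filter_upwards [continuous_subtype_val.continuousAt.eventually (eventually_agree x.1 n)]
    with y hy
  have hw : ∀ i, IsPrefix ((x.1 i).take n) (x.1 i) := fun i => .take_self _ _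
  have hw' : ∀ i, IsPrefix ((x.1 i).take n) (y.1 i) := fun i =>
    OmegaWord.isPrefix_take fun m hm => (hy i m hm).symm
  exact (h.sound y.1 (g.fn y.1 y.2) ⟨y.2, rfl⟩ n _ hw').eq_of_isPrefix
    (h.sound x.1 (g.fn x.1 x.2) ⟨x.2, rfl⟩ n _ hw)
    (hn n le_rfl _ hw fun i => (OmegaWord.length_take _ _).ge)

theorem IsPrefix.agree {w : List A} {p p' : OmegaWord A} (h : IsPrefix w p)
    (h' : IsPrefix w p') {n m : ℕ} (hn : n ≤ w.length) (hm : m < n) : p' m = p m :=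
  h'.eq_of_isPrefix h (hm.trans_le hn)

/-- `Ψ` answers once the prefixes force the value at all domain points that extend them. As `FinWord
A` is discrete, `f` is locally constant on its domain, so this eventually happens. -/
theorem exists_wordApprox_of_continuous {f : (Fin k → OmegaWord A) →. FinWord A}
    (hf : PFunContinuous f) : ∃ Ψ, WordApprox f Ψ := by
  classical
  let P : (Fin k → List A) → List A → Prop := fun w u =>
    (∃ p, (∀ i, IsPrefix (w i) (p i)) ∧ (f p).Dom) ∧
      ∀ p, ∀ v ∈ f p, (∀ i, IsPrefix (w i) (p i)) → u = v
  refine ⟨fun _ w => if h : ∃ u, P w u then some h.choose else none, ?_, ?_⟩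
  · intro p v hv t w hw u hu
    split_ifs at hu with h
    cases hu
    exact h.choose_spec.2 p v hv hw
  · rintro p v ⟨hp, rfl⟩
    have : DiscreteTopology (FinWord A) := ⟨rfl⟩
    have h1 := (IsLocallyConstant.iff_eventually_eq _).1
      ((IsLocallyConstant.iff_continuous _).2 hf) ⟨p, hp⟩
    rw [nhds_subtype, eventually_comap] at h1
    obtain ⟨n, hn⟩ := exists_of_eventually h1
    refine ⟨n, fun t _ w hw hl => ?_⟩
    have : ∃ u, P w u := by
      refine ⟨(f p).get hp, ⟨p, hw, hp⟩, ?_⟩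
      rintro p' v ⟨hp', rfl⟩ hw'
      exact (hn p' (fun i m hm => (hw i).agree (hw' i) (hl i) hm) ⟨p', hp'⟩ rfl).symm
    simp [this]

/-- `Φ t w` is a word of maximal length, up to `t`, that is a prefix of the values at all domain
points extending `w`. Without the cut-off at `t` a maximum need not exist, for example if no domain
point extends `w`. -/
theorem exists_seqApprox_of_continuous {g : (Fin k → OmegaWord A) →. OmegaWord A}
    (hg : PFunContinuous g) : ∃ Φ, SeqApprox (MultiFun.ofPFun g) Φ := by
  classical
  let P : (Fin k → List A) → List A → Prop := fun w u =>
    ∀ p, ∀ q ∈ g p, (∀ i, IsPrefix (w i) (p i)) → IsPrefix u q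
  let Q : (Fin k → List A) → ℕ → Prop := fun w n => ∃ u, u.length = n ∧ P w u
  have hQ : ∀ w t, Q w (Nat.findGreatest (Q w) t) := fun w t =>
    Nat.findGreatest_spec (P := Q w) (Nat.zero_le t) ⟨[], rfl, fun _ _ _ _ i c h => by simp at h⟩
  refine ⟨fun t w => (hQ w t).choose, fun p q hq t w hw => ?_, ?_⟩
  · exact (hQ w t).choose_spec.2 p q hq hw
  · rintro p q ⟨hp, rfl⟩ j
    have h1 : ∀ᶠ p' in 𝓝 p, ∀ x : g.Dom, x.1 = p' → ∀ i < j, (g.fn x.1 x.2) i = (g p).get hp i := by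
      have := hg.continuousAt (x := ⟨p, hp⟩) |>.eventually
        (p := fun q => ∀ i < j, q i = (g p).get hp i) ?_
      · rw [nhds_subtype, eventually_comap] at this
        exact this
      · have h := eventually_agree (k := 1) (fun _ => (g p).get hp) j
        have hc : Continuous fun q : OmegaWord A => fun _ : Fin 1 => q :=
          continuous_pi fun _ => continuous_id
        filter_upwards [hc.continuousAt.eventually h] with q hq using hq 0
    obtain ⟨n, hn⟩ := exists_of_eventually h1
    refine ⟨max n j, fun t ht w hw hl => ?_⟩
    rw [(hQ w t).choose_spec.1]
    refine Nat.le_findGreatest ((le_max_right _ _).trans ht)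
      ⟨OmegaWord.take ((g p).get hp) j, by simp, ?_⟩
    rintro p' q ⟨hp', rfl⟩ hw'
    exact OmegaWord.isPrefix_take fun m hm => (hn p' (fun i m hm =>
      (hw i).agree (hw' i) ((le_max_left _ _).trans (hl i)) hm) ⟨p', hp'⟩ rfl m hm).symm

end Continuity

/-! ## Type-2 machines on finite prefixes -/

namespace TypeTwoMachine

variable {A : Type u} {k : ℕ} {M : TypeTwoMachine A k}

theorem out_prefix_of_step {p : Fin k → OmegaWord A} {c c' : M.Config}
    (h : M.step p c = some c') : c.out <+: c'.out := by
  obtain ⟨t, -, rfl⟩ := Option.map_eq_some_iff.1 h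
  exact List.prefix_append _ _

theorem run_succ_eq_some {p : Fin k → OmegaWord A} {n : ℕ} {c' : M.Config}
    (h : M.run p (n + 1) = some c') : ∃ c, M.run p n = some c ∧ M.step p c = some c' :=
  Option.bind_eq_some_iff.1 h

theorem out_prefix_of_run {p : Fin k → OmegaWord A} {n m : ℕ} (hnm : n ≤ m) {c c' : M.Config}
    (h : M.run p n = some c) (h' : M.run p m = some c') : c.out <+: c'.out := by
  induction m, hnm using Nat.le_induction generalizing c' with
  | base => rw [h] at h'; cases h'; exact List.prefix_rfl
  | succ m _ ih =>
    obtain ⟨c₁, h1, h2⟩ := run_succ_eq_some h'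
    exact (ih h1).trans (out_prefix_of_step h2)

theorem getElem?_out_eq {p : Fin k → OmegaWord A} {n m j : ℕ} {c c' : M.Config}
    (h : M.run p n = some c) (h' : M.run p m = some c') {a a' : A}
    (ha : c.out[j]? = some a) (ha' : c'.out[j]? = some a') : a = a' := by
  have key : ∀ {l l' : List A}, l <+: l' → l[j]? = some a → l'[j]? = some a := by
    rintro l _ ⟨l', rfl⟩ hl
    rw [List.getElem?_append_left (List.getElem?_eq_some_iff.1 hl).1, hl]
  have key' : ∀ {l l' : List A}, l <+: l' → l[j]? = some a' → l'[j]? = some a' := by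
    rintro l _ ⟨l', rfl⟩ hl
    rw [List.getElem?_append_left (List.getElem?_eq_some_iff.1 hl).1, hl]
  rcases le_total n m with hnm | hnm
  · exact Option.some.inj ((key (out_prefix_of_run hnm h h') ha).symm.trans ha')
  · exact Option.some.inj (ha.symm.trans (key' (out_prefix_of_run hnm h' h) ha'))

theorem isPrefix_out {p : Fin k → OmegaWord A} {q : OmegaWord A} (hq : M.OutputsSeq p q) {n : ℕ}
    {c : M.Config} (h : M.run p n = some c) : IsPrefix c.out q := by
  intro i a ha
  obtain ⟨m, c', h', hc'⟩ := hq.2 i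
  exact getElem?_out_eq h h' ha hc'

theorem OutputsSeq.unique {p : Fin k → OmegaWord A} {q q' : OmegaWord A}
    (h : M.OutputsSeq p q) (h' : M.OutputsSeq p q') : q = q' := by
  funext j
  obtain ⟨n, c, h1, h2⟩ := h.2 j
  exact isPrefix_out h' h1 j _ h2

theorem run_le {p : Fin k → OmegaWord A} {n m : ℕ} {c c' : M.Config}
    (h : M.run p n = some c) (hs : M.step p c = none) (h' : M.run p m = some c') : m ≤ n := by
  by_contra! hlt
  have : M.run p (n + 1) = none := by simp [run, h, hs]
  have h2 : ∀ d, M.run p (n + 1 + d) = none := fun d => by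
    induction d with
    | zero => exact this
    | succ d ih => rw [← Nat.add_assoc, run, ih, Option.bind_none]
  obtain ⟨d, rfl⟩ := Nat.exists_eq_add_of_le hlt
  rw [h2] at h'
  cases h'

theorem OutputsWord.unique {p : Fin k → OmegaWord A} {v v' : FinWord A}
    (h : M.OutputsWord p v) (h' : M.OutputsWord p v') : v = v' := by
  obtain ⟨n, c, h1, h2, rfl⟩ := h
  obtain ⟨n', c', h1', h2', rfl⟩ := h'
  have := (run_le h1 h2 h1').antisymm (run_le h1' h2' h1)
  subst this
  rw [h1] at h1'
  cases h1'
  rfl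

/-- A configuration with logged work tapes. -/
abbrev SymConf (M : TypeTwoMachine A k) :=
  M.State × (Fin k → ℕ) × (Fin M.workTapes → LogTape M.Work) × List A

/-- The symbolic configuration represents the configuration. -/
def SymRel (c : M.SymConf) (κ : M.Config) : Prop :=
  c.1 = κ.state ∧ c.2.1 = κ.inputHead ∧
    (∀ j z, (c.2.2.1 j).read default ((c.2.2.1 j).1 + z) = (κ.work j).nth z) ∧ c.2.2.2 = κ.out

/-- The data that determine the next action; an input symbol beyond the given prefix is
missing. -/
abbrev View (M : TypeTwoMachine A k) :=
  M.State × (Fin k → Option A) × (Fin M.workTapes → M.Work)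

/-- The view of a configuration, if the prefixes `w` of the inputs are known. -/
def view (w : Fin k → List A) (c : M.SymConf) : M.View :=
  (c.1, fun i => (w i)[c.2.1 i]?, fun j => (c.2.2.1 j).read default (c.2.2.1 j).1)

open Classical in
/-- The action of the machine for a view: `none` if an input symbol is missing. -/
noncomputable def viewNext (M : TypeTwoMachine A k) (d : M.View) :
    Option (Option (M.State × (Fin k → Option Turing.Dir) ×
      (Fin M.workTapes → M.Work × Option Turing.Dir) × Option A)) :=
  if h : ∃ a : Fin k → A, ∀ i, d.2.1 i = some (a i) then some (M.next d.1 h.choose d.2.2) else none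

/-- Perform the action for a view. The Boolean tells whether the machine has halted. -/
noncomputable def act (d : M.View) (c : Bool × M.SymConf) : Bool × M.SymConf :=
  match M.viewNext d with
  | none => c
  | some none => (true, c.2)
  | some (some t) => (false, t.1, fun i => moveInput (t.2.1 i) (c.2.2.1 i),
      fun j => ((c.2.2.2.1 j).write (t.2.2.1 j).1).move (t.2.2.1 j).2,
      c.2.2.2.2 ++ t.2.2.2.toList)

/-- One step on prefixes of the inputs. -/
noncomputable def symStep (w : Fin k → List A) (c : Bool × M.SymConf) : Bool × M.SymConf :=
  act (view w c.2) c

/-- The initial symbolic configuration. -/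
def symStart (M : TypeTwoMachine A k) : Bool × M.SymConf :=
  (false, M.start, fun _ => 0, fun _ => (0, []), [])

theorem symRel_start : SymRel M.symStart.2 M.init := by
  refine ⟨rfl, rfl, fun j z => ?_, rfl⟩
  simp only [symStart, LogTape.read, init, List.lookup_nil, Option.getD_none]
  change _ = Turing.Tape.nth (default : Turing.Tape M.Work) z
  rcases z with (_ | n) | n <;> rfl

theorem SymRel.view_eq {w : Fin k → List A} {c : M.SymConf} {κ : M.Config}
    (h : SymRel c κ) : view w c = (κ.state, fun i => (w i)[κ.inputHead i]?,
      fun j => (κ.work j).head) := by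
  refine Prod.ext h.1 (Prod.ext ?_ (funext fun j => ?_))
  · simp [view, h.2.1]
  · have := h.2.2.1 j 0
    simpa [view] using this

theorem viewNext_eq {w : Fin k → List A} {p : Fin k → OmegaWord A}
    (hw : ∀ i, IsPrefix (w i) (p i)) {c : M.SymConf} {κ : M.Config} (h : SymRel c κ) :
    (M.viewNext (view w c) = none ∧ ∃ i, (w i).length ≤ κ.inputHead i) ∨
    M.viewNext (view w c) = some (M.next κ.state (fun i => p i (κ.inputHead i))
      fun j => (κ.work j).head) := by
  rw [h.view_eq]
  unfold viewNext
  split_ifs with ha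
  · right
    have := ha.choose_spec
    congr 2
    funext i
    exact hw i _ _ (this i)
  · refine Or.inl ⟨rfl, ?_⟩
    by_contra! hlt
    exact ha ⟨fun i => p i (κ.inputHead i), fun i => (hw i).getElem?_eq (hlt i)⟩

/-- Logs use absolute positions, while `Turing.Tape.nth` counts from the head; a move therefore
shifts the relative index. -/
theorem nth_actWork {W : Type} [Inhabited W] (a : W × Option Turing.Dir) (T : LogTape W)
    (T' : Turing.Tape W) (h : ∀ z, T.read default (T.1 + z) = T'.nth z) (z : ℤ) :
    ((T.write a.1).move a.2).read default (((T.write a.1).move a.2).1 + z) =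
      (actWork a T').nth z := by
  obtain ⟨x, d⟩ := a
  rw [LogTape.read_move]
  rcases d with _ | _ | _
  · have hp : ((T.write x).move none).1 + z = T.1 + z := rfl
    rw [hp, LogTape.read_write]
    simp [actWork, h]
  · have hp : ((T.write x).move (some .left)).1 + z = T.1 + (z - 1) := by
      simp only [LogTape.move, LogTape.write]; ring
    rw [hp, LogTape.read_write]
    simp [actWork, h]
  · have hp : ((T.write x).move (some .right)).1 + z = T.1 + (z + 1) := by
      simp only [LogTape.move, LogTape.write]; ring
    rw [hp, LogTape.read_write]
    simp [actWork, h]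

/-- A step on prefixes is stuck, or finds that the machine halts, or simulates a step. -/
theorem symStep_cases {w : Fin k → List A} {p : Fin k → OmegaWord A}
    (hw : ∀ i, IsPrefix (w i) (p i)) {c : Bool × M.SymConf} {κ : M.Config} (h : SymRel c.2 κ) :
    (symStep w c = c ∧ ∃ i, (w i).length ≤ κ.inputHead i) ∨
    (symStep w c = (true, c.2) ∧ M.step p κ = none) ∨
    ∃ c' κ', symStep w c = (false, c') ∧ M.step p κ = some κ' ∧ SymRel c' κ' := by
  rcases viewNext_eq hw h with ⟨h1, h2⟩ | h1
  · exact Or.inl ⟨by simp [symStep, act, h1], h2⟩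
  · right
    cases ht : M.next κ.state (fun i => p i (κ.inputHead i)) (fun j => (κ.work j).head) with
    | none =>
      rw [ht] at h1
      exact Or.inl ⟨by simp [symStep, act, h1], by simp [step, ht]⟩
    | some t =>
      rw [ht] at h1
      refine Or.inr ⟨_, _, by simp only [symStep, act, h1]; rfl,
        by simp only [step, ht, Option.map_some]; rfl, rfl, ?_, fun j z => ?_, ?_⟩
      · simp [h.2.1]
      · exact nth_actWork _ _ _ (h.2.2.1 j) z
      · simp [h.2.2.2]

/-- The true step number `n` may stay behind `r`, since stuck and halted steps do not advance the
machine. -/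
theorem symStep_sound {w : Fin k → List A} {p : Fin k → OmegaWord A}
    (hw : ∀ i, IsPrefix (w i) (p i)) (r : ℕ) : ∃ n κ, M.run p n = some κ ∧
      SymRel ((symStep w)^[r] M.symStart).2 κ ∧
      (((symStep w)^[r] M.symStart).1 = true → M.step p κ = none) := by
  induction r with
  | zero => exact ⟨0, _, rfl, symRel_start, by simp [symStart]⟩
  | succ r ih =>
    obtain ⟨n, κ, h1, h2, h3⟩ := ih
    rw [Function.iterate_succ_apply']
    rcases symStep_cases hw h2 with ⟨h, -⟩ | ⟨h, h4⟩ | ⟨c', κ', h, h4, h5⟩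
    · rw [h]; exact ⟨n, κ, h1, h2, h3⟩
    · rw [h]; exact ⟨n, κ, h1, h2, fun _ => h4⟩
    · rw [h]; exact ⟨n + 1, κ', by simp [run, h1, h4], h5, by simp⟩

theorem symStep_complete {p : Fin k → OmegaWord A} {r : ℕ} {κ : M.Config}
    (hr : M.run p r = some κ) : ∃ n, ∀ w : Fin k → List A, (∀ i, IsPrefix (w i) (p i)) →
      (∀ i, n ≤ (w i).length) → SymRel ((symStep w)^[r] M.symStart).2 κ := by
  induction r generalizing κ with
  | zero => cases hr; exact ⟨0, fun w _ _ => symRel_start⟩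
  | succ r ih =>
    obtain ⟨κ₁, h1, h2⟩ := run_succ_eq_some hr
    obtain ⟨n, hn⟩ := ih h1
    -- The second bound puts every scanned input cell inside the known prefixes, so this step cannot
    -- be stuck.
    refine ⟨max n (Finset.univ.sup κ₁.inputHead + 1), fun w hw hl => ?_⟩
    have h3 := hn w hw fun i => (le_max_left _ _).trans (hl i)
    rw [Function.iterate_succ_apply']
    rcases symStep_cases hw h3 with ⟨h, i, hi⟩ | ⟨h, h4⟩ | ⟨c', κ', h, h4, h5⟩
    · have h4 := (le_max_right _ _).trans (hl i)
      have h5 : κ₁.inputHead i ≤ _ := Finset.le_sup (Finset.mem_univ i)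
      omega
    · rw [h2] at h4; cases h4
    · rw [h2] at h4; cases h4; rw [h]; exact h5

theorem out_prefix_symStep (w : Fin k → List A) (c : Bool × M.SymConf) :
    c.2.2.2.2 <+: (symStep w c).2.2.2.2 := by
  unfold symStep act
  split
  · exact List.prefix_rfl
  · exact List.prefix_rfl
  · exact List.prefix_append _ _

theorem length_out_iterate (w : Fin k → List A) (c : Bool × M.SymConf) {r t : ℕ} (h : r ≤ t) :
    ((symStep w)^[r] c).2.2.2.2.length ≤ ((symStep w)^[t] c).2.2.2.2.length := by
  induction t, h using Nat.le_induction with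
  | base => exact le_rfl
  | succ t _ ih =>
    rw [Function.iterate_succ_apply']
    exact ih.trans (out_prefix_symStep w _).length_le

/-- The word on the output tape after `t` steps on prefixes. -/
noncomputable def seqApprox (M : TypeTwoMachine A k) (t : ℕ) (w : Fin k → List A) : List A :=
  ((symStep w)^[t] M.symStart).2.2.2.2

/-- The word on the output tape if the machine halts in less than `t` steps on prefixes. -/
noncomputable def wordApprox (M : TypeTwoMachine A k) (t : ℕ) (w : Fin k → List A) :
    Option (List A) :=
  bif ((symStep w)^[t] M.symStart).1 then some (M.seqApprox t w) else none

theorem seqApprox_spec (M : TypeTwoMachine A k) :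
    SeqApprox (fun p => {q | M.OutputsSeq p q}) M.seqApprox := by
  refine ⟨fun p q hq t w hw => ?_, fun p q hq j => ?_⟩
  · obtain ⟨n, κ, h1, h2, -⟩ := symStep_sound (M := M) hw t
    have := isPrefix_out hq h1
    rw [← h2.2.2.2] at this
    exact this
  · obtain ⟨r, κ, h1, h2⟩ := hq.2 j
    obtain ⟨n, hn⟩ := symStep_complete h1
    refine ⟨max n r, fun t ht w hw hl => ?_⟩
    have h3 := hn w hw fun i => (le_max_left _ _).trans (hl i)
    refine le_trans ?_ (length_out_iterate w _ ((le_max_right _ _).trans ht))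
    rw [h3.2.2.2]
    exact (List.getElem?_eq_some_iff.1 h2).1.le

theorem wordApprox_spec (M : TypeTwoMachine A k) {f : (Fin k → OmegaWord A) →. FinWord A}
    (hf : ∀ p, ∀ v ∈ f p, M.OutputsWord p v) : WordApprox f M.wordApprox := by
  refine ⟨fun p v hv t w hw u hu => ?_, fun p v hv => ?_⟩
  · obtain ⟨n, κ, h1, h2, h3⟩ := symStep_sound (M := M) hw t
    unfold wordApprox at hu
    cases hb : ((symStep w)^[t] M.symStart).1 with
    | false => simp [hb] at hu
    | true =>
      rw [hb, cond_true] at hu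
      cases hu
      exact OutputsWord.unique ⟨n, κ, h1, h3 hb, h2.2.2.2.symm⟩ (hf p v hv)
  · obtain ⟨r, κ, h1, h2, -⟩ := hf p v hv
    obtain ⟨n, hn⟩ := symStep_complete h1
    -- The halting configuration is reached after `r` steps, and one further step is needed to set
    -- the Boolean.
    refine ⟨max (max n (Finset.univ.sup κ.inputHead + 1)) (r + 1), fun t ht w hw hl => ?_⟩
    have hl' : ∀ i, max n (Finset.univ.sup κ.inputHead + 1) ≤ (w i).length :=
      fun i => (le_max_left _ _).trans (hl i)
    have h3 := hn w hw fun i => (le_max_left _ _).trans (hl' i)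
    have h4 : ∀ c : Bool × M.SymConf, SymRel c.2 κ → symStep w c = (true, c.2) := by
      intro c hc
      rcases symStep_cases hw hc with ⟨h, i, hi⟩ | ⟨h, -⟩ | ⟨c', κ', h, h4, h5⟩
      · have h4 := (le_max_right _ _).trans (hl' i)
        have h5 : κ.inputHead i ≤ _ := Finset.le_sup (Finset.mem_univ i)
        omega
      · exact h
      · rw [h2] at h4; cases h4
    have h5 : ((symStep w)^[t] M.symStart).1 = true := by
      obtain ⟨s, hs⟩ := Nat.exists_eq_add_of_le' ((le_max_right _ _).trans ht)
      rw [hs, show s + (r + 1) = s + 1 + r by ring, Function.iterate_add_apply _ (s + 1) r,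
        Function.iterate_succ_apply, h4 _ h3, Function.iterate_fixed (h4 (true, _) h3)]
    simp [wordApprox, h5]

/-! ### Primitive recursiveness of the simulation -/

section Primrec

variable [Primcodable A] [Primcodable M.State] [Primcodable M.Work]

theorem primrec_act (d : M.View) : Primrec (act d) := by
  unfold act
  rcases M.viewNext d with _ | _ | t
  · exact Primrec.id
  · exact Primrec.pair (Primrec.const _) Primrec.snd
  · refine Primrec.pair (Primrec.const _) (Primrec.pair (Primrec.const _) (Primrec.pair
      (Primrec.pi_mk fun i => ?_) (Primrec.pair (Primrec.pi_mk fun j => ?_) ?_)))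
    · have h : Primrec fun c : Bool × M.SymConf => c.2.2.1 i :=
        Primrec.pi_apply (Primrec.fst.comp (Primrec.snd.comp Primrec.snd)) i
      rcases t.2.1 i with _ | _ | _
      · exact h
      · exact Primrec.pred.comp h
      · exact Primrec.succ.comp h
    · exact (LogTape.primrec_move _).comp (LogTape.primrec_write.comp (Primrec.const _)
        (Primrec.pi_apply (Primrec.fst.comp (Primrec.snd.comp (Primrec.snd.comp Primrec.snd))) j))
    · exact Primrec.list_append.comp
        (Primrec.snd.comp (Primrec.snd.comp (Primrec.snd.comp Primrec.snd))) (Primrec.const _)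

variable [Finite A]

/-- The transition table is an arbitrary function, but it is consulted only through the view, which
ranges over a finite type. It is thus enough that `act d` is primitive recursive for each fixed `d`.
-/
theorem primrec_symStep : Primrec₂ (symStep (M := M)) := by
  have hv : Primrec fun x : (Fin k → List A) × (Bool × M.SymConf) => view x.1 x.2.2 := by
    have h := (Primrec.snd (α := Bool) (β := M.SymConf)).comp
      (Primrec.snd (α := Fin k → List A))
    have hj : ∀ j, Primrec fun x : (Fin k → List A) × (Bool × M.SymConf) => x.2.2.2.2.1 j :=
      Primrec.pi_apply (Primrec.fst.comp (Primrec.snd.comp (Primrec.snd.comp h)))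
    refine Primrec.pair (Primrec.fst.comp h) (Primrec.pair (Primrec.pi_mk fun i => ?_)
      (Primrec.pi_mk fun j => ?_))
    · exact Primrec.list_getElem?.comp (Primrec.pi_apply Primrec.fst i)
        (Primrec.pi_apply (Primrec.fst.comp (Primrec.snd.comp h)) i)
    · exact (LogTape.primrec_read _).comp (hj j) (Primrec.fst.comp (hj j))
  exact (Primrec.finite_uncurry primrec_act).comp hv Primrec.snd

theorem primrec_iterate_symStep : Primrec fun x : ℕ × (Fin k → List A) =>
    (symStep x.2)^[x.1] M.symStart :=
  Primrec.nat_iterate Primrec.fst (Primrec.const _)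
    (primrec_symStep.comp (Primrec.snd.comp Primrec.fst) Primrec.snd).to₂

theorem primrec_seqApprox : Primrec fun x : ℕ × (Fin k → List A) => M.seqApprox x.1 x.2 :=
  Primrec.snd.comp (Primrec.snd.comp (Primrec.snd.comp (Primrec.snd.comp
    primrec_iterate_symStep)))

theorem primrec_wordApprox : Primrec fun x : ℕ × (Fin k → List A) => M.wordApprox x.1 x.2 :=
  Primrec.cond (Primrec.fst.comp primrec_iterate_symStep)
    (Primrec.option_some.comp primrec_seqApprox) (Primrec.const _)

end Primrec

end TypeTwoMachine

/-! ### Computable functions have primitive recursive approximations -/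

variable {A : Type u} {k : ℕ} [Finite A] [Primcodable A]

theorem ComputableSeq.exists_seqApprox {f : (Fin k → OmegaWord A) →. OmegaWord A}
    (hf : ComputableSeq f) : ∃ Φ, SeqApprox (MultiFun.ofPFun f) Φ ∧
      Primrec fun x : ℕ × (Fin k → List A) => Φ x.1 x.2 := by
  obtain ⟨g, ⟨M, hM⟩, hg⟩ := hf
  let := Primcodable.ofFinite M.State
  let := Primcodable.ofFinite M.Work
  have h := M.seqApprox_spec
  exact ⟨M.seqApprox, ⟨fun p q hq => h.sound p q ((hM p q).1 (hg p q hq)),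
    fun p q hq => h.complete p q ((hM p q).1 (hg p q hq))⟩, M.primrec_seqApprox⟩

theorem ComputableWord.exists_wordApprox {f : (Fin k → OmegaWord A) →. FinWord A}
    (hf : ComputableWord f) : ∃ Ψ, WordApprox f Ψ ∧
      Primrec fun x : ℕ × (Fin k → List A) => Ψ x.1 x.2 := by
  obtain ⟨g, ⟨M, hM⟩, hg⟩ := hf
  let := Primcodable.ofFinite M.State
  let := Primcodable.ofFinite M.Work
  exact ⟨M.wordApprox, M.wordApprox_spec fun p v hv => (hM p v).1 (hg p v hv),
    M.primrec_wordApprox⟩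

open Turing Turing.PartrecToTM2

/-! ## Stacks on work tapes -/

/-- The operations on a work tape that holds a list, with the head on the first element. -/
inductive ListOp
  | nop
  | consBlank
  | tail
  | set (a : Γ')

namespace ListOp

/-- The effect on the list. -/
def apply : ListOp → List (Option Γ') → List (Option Γ')
  | nop, l => l
  | consBlank, l => none :: l
  | tail, l => l.tail
  | set a, l => some a :: l.tail

/-- The action on the tape, if `h` is the scanned symbol. -/
def action (h : Option Γ') : ListOp → Option Γ' × Option Dir
  | nop => (h, none)
  | consBlank => (h, some Dir.left)
  | tail => (none, some Dir.right)
  | set a => (some a, none)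

@[simp] theorem apply_nop (l : List (Option Γ')) : nop.apply l = l := rfl

@[simp] theorem apply_consBlank (l : List (Option Γ')) : consBlank.apply l = none :: l := rfl

@[simp] theorem apply_tail (l : List (Option Γ')) : tail.apply l = l.tail := rfl

@[simp] theorem apply_set (a : Γ') (l : List (Option Γ')) : (set a).apply l = some a :: l.tail :=
  rfl

theorem head_mk₁ (l : List (Option Γ')) : (Tape.mk₁ l).head = l.headI := rfl

/-- The top of the stack is under the head and everything to its left is blank. A machine step
writes before it moves, so a push takes two steps, `consBlank` and then `set`; a pop erases the cell
before leaving it. -/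
theorem actWork_action (o : ListOp) (l : List (Option Γ')) :
    TypeTwoMachine.actWork (o.action l.headI) (Tape.mk₁ l) = Tape.mk₁ (o.apply l) := by
  cases o with
  | nop => exact Tape.write_self (Tape.mk₁ l)
  | consBlank =>
    simp only [TypeTwoMachine.actWork, action, apply]
    rw [← head_mk₁, Tape.write_self, Tape.mk₁, Tape.mk₂, Tape.move_left_mk', ListBlank.cons_mk]
    rfl
  | tail =>
    simp only [TypeTwoMachine.actWork, action, apply]
    rw [Tape.mk₁, Tape.mk₂, ← ListBlank.cons_head_tail (ListBlank.mk l), Tape.write_mk',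
      Tape.move_right_mk', ListBlank.head_cons, ListBlank.tail_cons, ListBlank.tail_mk]
    -- The erased cell is absorbed by the blank half to the left of the head.
    have : (ListBlank.mk ([] : List (Option Γ'))).cons none = ListBlank.mk [] := by
      conv_rhs => rw [← ListBlank.cons_head_tail (ListBlank.mk [])]
      rfl
    rw [this]
    rfl
  | set a =>
    simp only [TypeTwoMachine.actWork, action, apply]
    rw [Tape.mk₁, Tape.mk₂, ← ListBlank.cons_head_tail (ListBlank.mk l), Tape.write_mk',
      ListBlank.tail_mk, ListBlank.cons_mk]
    rfl

end ListOp

/-! ## A loop around a stack machine -/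

/-- Statements of a machine with the stacks of `Turing.PartrecToTM2`. -/
abbrev StackStmt (Λ σ : Type) := TM2.Stmt (fun _ : K' => Γ') Λ σ

/-- A stack machine that is run in a loop. In each round, a column of input symbols is read, the
statement `load` for this column is executed, and the machine is run until it halts; then a word
up to an end marker is popped from the main stack and is translated into an output by `dec`. -/
structure Loop (A : Type u) (k : ℕ) where
  Λ : Type
  σ : Type
  [finiteVar : Finite σ]
  tr : Λ → StackStmt Λ σ
  load : (Fin k → A) → StackStmt Λ σ
  v₀ : σ
  dec : List Γ' → Option A
  bound : ℕ
  support : Finset Λ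
  support_tr : ∀ l ∈ support, TM2.SupportsStmt support (tr l)
  support_load : ∀ a, TM2.SupportsStmt support (load a)

/-- The control states of a loop. -/
inductive LoopState (Λ σ : Type)
  | start
  | read
  | exec (q : StackStmt Λ σ) (v : σ)
  | push (i : K') (a : Γ') (q : StackStmt Λ σ) (v : σ)
  | post (l : List Γ')

namespace Loop

attribute [instance] finiteVar

variable {A : Type u} {k : ℕ} (P : Loop A k)

/-- Perform `o` on tape `i`. -/
def only (i : K') (o : ListOp) : K' → ListOp := Function.update (fun _ => ListOp.nop) i o

/-- The next state, whether the input heads move on, the operations on the work tapes, and the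
output symbol. -/
def next : LoopState P.Λ P.σ → (Fin k → A) → (K' → Option Γ') →
    LoopState P.Λ P.σ × Bool × (K' → ListOp) × Option A
  | .start, _, _ => (.read, false, only K'.main (.set Γ'.cons), none)
  | .read, a, _ => (.exec (P.load a) P.v₀, true, fun _ => .nop, none)
  | .exec (.push i f q) v, _, _ => (.push i (f v) q v, false, only i .consBlank, none)
  | .exec (.peek i f q) v, _, h => (.exec q (f v (h i)), false, fun _ => .nop, none)
  | .exec (.pop i f q) v, _, h => (.exec q (f v (h i)), false, only i .tail, none)
  | .exec (.load f q) v, _, _ => (.exec q (f v), false, fun _ => .nop, none)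
  | .exec (.branch f q₁ q₂) v, _, _ => (.exec (cond (f v) q₁ q₂) v, false, fun _ => .nop, none)
  | .exec (.goto f) v, _, _ => (.exec (P.tr (f v)) v, false, fun _ => .nop, none)
  | .exec .halt _, _, _ => (.post [], false, fun _ => .nop, none)
  | .push i a q v, _, _ => (.exec q v, false, only i (.set a), none)
  | .post l, _, h =>
    match h K'.main with
    | none => (.read, false, fun _ => .nop, none)
    | some x =>
      if natEnd x then (.read, false, only K'.main .tail, P.dec l)
      else if l.length < P.bound then (.post (l ++ [x]), false, only K'.main .tail, none)
      else (.read, false, fun _ => .nop, none)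

/-- The statements that can occur. -/
def stmts : Set (StackStmt P.Λ P.σ) :=
  (⋃ l ∈ P.support, ↑(TM2.stmts₁ (P.tr l))) ∪ ⋃ a, ↑(TM2.stmts₁ (P.load a))

theorem finite_stmts [Finite A] : P.stmts.Finite :=
  (P.support.finite_toSet.biUnion fun _ _ => Finset.finite_toSet _).union
    (Set.finite_iUnion fun _ => Finset.finite_toSet _)

variable {P} in
theorem mem_stmts_of_mem {q q' : StackStmt P.Λ P.σ} (h : q ∈ P.stmts)
    (h' : q' ∈ TM2.stmts₁ q) : q' ∈ P.stmts := by
  simp only [stmts, Set.mem_union, Set.mem_iUnion, Finset.mem_coe] at h ⊢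
  rcases h with ⟨l, hl, h⟩ | ⟨a, h⟩
  · exact Or.inl ⟨l, hl, TM2.stmts₁_trans h h'⟩
  · exact Or.inr ⟨a, TM2.stmts₁_trans h h'⟩

theorem tr_mem_stmts {l : P.Λ} (h : l ∈ P.support) : P.tr l ∈ P.stmts := by
  simp only [stmts, Set.mem_union, Set.mem_iUnion, Finset.mem_coe]
  exact Or.inl ⟨l, h, TM2.stmts₁_self⟩

theorem load_mem_stmts (a : Fin k → A) : P.load a ∈ P.stmts := by
  simp only [stmts, Set.mem_union, Set.mem_iUnion, Finset.mem_coe]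
  exact Or.inr ⟨a, TM2.stmts₁_self⟩

variable {P} in
theorem supportsStmt_of_mem {q : StackStmt P.Λ P.σ} (h : q ∈ P.stmts) :
    TM2.SupportsStmt P.support q := by
  simp only [stmts, Set.mem_union, Set.mem_iUnion, Finset.mem_coe] at h
  rcases h with ⟨l, hl, h⟩ | ⟨a, h⟩
  · exact TM2.stmts₁_supportsStmt_mono h (P.support_tr l hl)
  · exact TM2.stmts₁_supportsStmt_mono h (P.support_load a)

/-- The control states that can occur. -/
def IsState : LoopState P.Λ P.σ → Prop
  | .exec q _ => q ∈ P.stmts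
  | .push _ _ q _ => q ∈ P.stmts
  | .post l => l.length ≤ P.bound
  | _ => True

/-- Every statement executed is a substatement of one of the finitely many supported or loading
statements, and `bound` limits the word collected in `post`. -/
instance finite_state [Finite A] : Finite {s // P.IsState s} := by
  have hQ := P.finite_stmts
  have : Finite P.stmts := hQ
  have hL : Finite {l : List Γ' // l.length ≤ P.bound} := List.finite_length_le Γ' P.bound
  have : Finite K' := Finite.of_surjective
    (fun i : Fin 4 => ![K'.main, K'.rev, K'.aux, K'.stack] i)
    (by rintro (_ | _ | _ | _); exacts [⟨0, rfl⟩, ⟨1, rfl⟩, ⟨2, rfl⟩, ⟨3, rfl⟩])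
  let F : Unit ⊕ Unit ⊕ (P.stmts × P.σ) ⊕ (K' × Γ' × P.stmts × P.σ) ⊕
      {l : List Γ' // l.length ≤ P.bound} → {s // P.IsState s} := fun x =>
    match x with
    | .inl _ => ⟨.start, trivial⟩
    | .inr (.inl _) => ⟨.read, trivial⟩
    | .inr (.inr (.inl y)) => ⟨.exec y.1 y.2, y.1.2⟩
    | .inr (.inr (.inr (.inl y))) => ⟨.push y.1 y.2.1 y.2.2.1 y.2.2.2, y.2.2.1.2⟩
    | .inr (.inr (.inr (.inr y))) => ⟨.post y.1, y.2⟩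
  refine Finite.of_surjective F ?_
  rintro ⟨_ | _ | ⟨q, v⟩ | ⟨i, a, q, v⟩ | l, h⟩
  · exact ⟨.inl (), rfl⟩
  · exact ⟨.inr (.inl ()), rfl⟩
  · exact ⟨.inr (.inr (.inl (⟨q, h⟩, v))), rfl⟩
  · exact ⟨.inr (.inr (.inr (.inl (i, a, ⟨q, h⟩, v)))), rfl⟩
  · exact ⟨.inr (.inr (.inr (.inr ⟨l, h⟩))), rfl⟩

theorem isState_next {s : LoopState P.Λ P.σ} (hs : P.IsState s) (a : Fin k → A)
    (h : K' → Option Γ') : P.IsState (P.next s a h).1 := by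
  rcases s with _ | _ | ⟨q, v⟩ | ⟨i, b, q, v⟩ | l
  · trivial
  · exact P.load_mem_stmts a
  · have hsub : ∀ q', q' ∈ TM2.stmts₁ q → q' ∈ P.stmts := fun q' => mem_stmts_of_mem hs
    cases q with
    | goto f => exact P.tr_mem_stmts (supportsStmt_of_mem hs v)
    | halt => exact Nat.zero_le _
    | branch f q₁ q₂ =>
      simp only [next]
      cases f v
      · exact hsub _ (by simp [TM2.stmts₁, TM2.stmts₁_self])
      · exact hsub _ (by simp [TM2.stmts₁, TM2.stmts₁_self])
    | _ => exact hsub _ (by simp [TM2.stmts₁, TM2.stmts₁_self])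
  · exact hs
  · simp only [next]
    split
    · trivial
    · split_ifs with h1 h2
      · trivial
      · simpa [IsState] using h2
      · trivial

/-- The stack on work tape `j`. -/
def stackOf : Fin 4 → K' := ![K'.main, K'.rev, K'.aux, K'.stack]

/-- The work tape that holds the stack. -/
def tapeOf : K' → Fin 4
  | .main => 0
  | .rev => 1
  | .aux => 2
  | .stack => 3

theorem stackOf_tapeOf (i : K') : stackOf (tapeOf i) = i := by
  cases i <;> rfl

/-- The Type-2 machine that performs the loop. -/
def machine [Finite A] : TypeTwoMachine A k where
  State := {s // P.IsState s}
  start := ⟨.start, trivial⟩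
  workTapes := 4
  Work := Option Γ'
  next s a h :=
    let r := P.next s.1 a fun i => h (tapeOf i)
    some (⟨r.1, P.isState_next s.2 _ _⟩, fun _ => bif r.2.1 then some Dir.right else none,
      fun j => (r.2.2.1 (stackOf j)).action (h j), r.2.2.2)

/-- A control state, the position of all input heads, the contents of the stacks, and the
output. -/
abbrev Conf := LoopState P.Λ P.σ × ℕ × (K' → List (Option Γ')) × List A

/-- One step of the loop on input `p`. -/
def step (p : Fin k → OmegaWord A) (x : P.Conf) : P.Conf :=
  let r := P.next x.1 (fun i => p i x.2.1) fun i => (x.2.2.1 i).headI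
  (r.1, bif r.2.1 then x.2.1 + 1 else x.2.1, fun i => (r.2.2.1 i).apply (x.2.2.1 i),
    x.2.2.2 ++ r.2.2.2.toList)

/-- The initial configuration. -/
def init : P.Conf := (.start, 0, fun _ => [], [])

/-- The simulation is in lock step. All input heads move together, so one number records their
positions. -/
theorem run_machine [Finite A] (p : Fin k → OmegaWord A) (n : ℕ) :
    ∃ κ, P.machine.run p n = some κ ∧ κ.state.1 = ((P.step p)^[n] P.init).1 ∧
      (κ.inputHead = fun _ => ((P.step p)^[n] P.init).2.1) ∧
      (κ.work = fun j => Tape.mk₁ (((P.step p)^[n] P.init).2.2.1 (stackOf j))) ∧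
      κ.out = ((P.step p)^[n] P.init).2.2.2 := by
  induction n with
  | zero => exact ⟨_, rfl, rfl, rfl, rfl, rfl⟩
  | succ n ih =>
    obtain ⟨⟨s, hd, wk, o⟩, h1, h2, h3, h4, h5⟩ := ih
    rw [Function.iterate_succ_apply']
    generalize (P.step p)^[n] P.init = x at *
    obtain ⟨x, m, T, o'⟩ := x
    dsimp only at h2 h3 h4 h5
    subst h3 h4 h5 h2
    rw [TypeTwoMachine.run, h1, Option.bind_some]
    refine ⟨_, rfl, ?_, ?_, ?_, ?_⟩
    · simp [machine, step, ListOp.head_mk₁, stackOf_tapeOf]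
    · funext i
      simp only [machine, step, ListOp.head_mk₁, stackOf_tapeOf]
      cases (P.next s.1 (fun i => p i m) fun i => (T i).headI).2.1 <;> rfl
    · funext j
      simp only [machine, step, ListOp.head_mk₁, stackOf_tapeOf]
      exact ListOp.actWork_action _ _
    · simp [machine, step, ListOp.head_mk₁, stackOf_tapeOf]

/-- The configuration `y` is reached from `x` on input `p`. -/
def Reaches (p : Fin k → OmegaWord A) (x y : P.Conf) : Prop := ∃ n, (P.step p)^[n] x = y

variable {P} {p : Fin k → OmegaWord A}

theorem Reaches.trans {x y z : P.Conf} (h : P.Reaches p x y) (h' : P.Reaches p y z) :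
    P.Reaches p x z := by
  obtain ⟨n, rfl⟩ := h
  obtain ⟨m, rfl⟩ := h'
  exact ⟨m + n, Function.iterate_add_apply _ _ _ _⟩

theorem Reaches.head {x y : P.Conf} (h : P.Reaches p (P.step p x) y) : P.Reaches p x y := by
  obtain ⟨n, rfl⟩ := h
  exact ⟨n + 1, rfl⟩

theorem Reaches.refl (x : P.Conf) : P.Reaches p x x := ⟨0, rfl⟩

/-- The tape contents for given stacks. -/
def lists (S : K' → List Γ') : K' → List (Option Γ') := fun i => (S i).map some

theorem lists_def (S : K' → List Γ') : lists S = fun i => (S i).map some := rfl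

theorem headI_map_some (l : List Γ') : (l.map some).headI = l.head? := by
  cases l <;> rfl

theorem headI_lists (S : K' → List Γ') (i : K') : (lists S i).headI = (S i).head? :=
  headI_map_some _

theorem apply_only (T : K' → List (Option Γ')) (i : K') (o : ListOp) :
    (fun j => (only i o j).apply (T j)) = Function.update T i (o.apply (T i)) := by
  funext j
  by_cases h : j = i
  · subst h; simp [only]
  · simp [only, h]

theorem update_lists (S : K' → List Γ') (i : K') (l : List Γ') :
    Function.update (lists S) i (l.map some) = lists (Function.update S i l) := by
  funext j
  by_cases h : j = i
  · subst h; simp [lists]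
  · simp [lists, h]

/-- The configuration of the loop for a configuration of the stack machine. -/
def ofCfg (P : Loop A k) (m : ℕ) (o : List A) : TM2.Cfg (fun _ : K' => Γ') P.Λ P.σ → P.Conf
  | ⟨some l, v, S⟩ => (.exec (P.tr l) v, m, lists S, o)
  | ⟨none, _, S⟩ => (.post [], m, lists S, o)

theorem reaches_stepAux (m : ℕ) (o : List A) (q : StackStmt P.Λ P.σ) (v : P.σ)
    (S : K' → List Γ') :
    P.Reaches p (.exec q v, m, lists S, o) (P.ofCfg m o (TM2.stepAux q v S)) := by
  induction q generalizing v S with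
  | push i f q ih =>
    refine Reaches.head (Reaches.head ?_)
    have := ih v (Function.update S i (f v :: S i))
    rw [← update_lists] at this
    simpa [step, next, apply_only, lists_def] using this
  | peek i f q ih =>
    refine Reaches.head ?_
    simpa [step, next, headI_lists] using ih (f v (S i).head?) S
  | pop i f q ih =>
    refine Reaches.head ?_
    have := ih (f v (S i).head?) (Function.update S i (S i).tail)
    rw [← update_lists] at this
    simpa [step, next, headI_map_some, apply_only, lists_def, List.map_tail] using this
  | load f q ih =>
    refine Reaches.head ?_
    simpa [step, next] using ih (f v) S
  | branch f q₁ q₂ ih₁ ih₂ =>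
    refine Reaches.head ?_
    simp only [TM2.stepAux, step, next, cond_false, Option.toList_none,
      List.append_nil]
    cases f v
    · exact ih₂ v S
    · exact ih₁ v S
  | goto f =>
    refine Reaches.head ?_
    simpa [step, next, ofCfg] using Reaches.refl _
  | halt =>
    refine Reaches.head ?_
    simpa [step, next, ofCfg] using Reaches.refl _

theorem reaches_ofCfg (m : ℕ) (o : List A) {a b : TM2.Cfg (fun _ : K' => Γ') P.Λ P.σ}
    (h : StateTransition.Reaches (TM2.step P.tr) a b) :
    P.Reaches p (P.ofCfg m o a) (P.ofCfg m o b) := by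
  induction h with
  | refl => exact Reaches.refl _
  | @tail b c _ h ih =>
    refine ih.trans ?_
    obtain ⟨_ | l, v, S⟩ := b
    · cases h
    · cases h
      exact reaches_stepAux m o _ v S

theorem reaches_post (m : ℕ) (o : List A) (S : K' → List Γ') {w rest : List Γ'}
    (hw : ∀ x ∈ w, natEnd x = false) (l : List Γ') (hl : (l ++ w).length ≤ P.bound) :
    P.Reaches p (.post l, m, lists (Function.update S K'.main (w ++ Γ'.cons :: rest)), o)
      (.read, m, lists (Function.update S K'.main rest), o ++ (P.dec (l ++ w)).toList) := by
  induction w generalizing l with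
  | nil =>
    refine Reaches.head ?_
    have h1 := Reaches.refl (p := p) (P := P) (.read, m,
      lists (Function.update S K'.main rest), o ++ (P.dec l).toList)
    simpa [step, next, headI_lists, apply_only, ← update_lists] using h1
  | cons x w ih =>
    refine Reaches.head ?_
    have h1 := ih (fun y hy => hw y (List.mem_cons_of_mem _ hy)) (l ++ [x]) (by simpa using hl)
    have hx := hw x List.mem_cons_self
    have hlt : l.length < P.bound := by
      simp only [List.length_append, List.length_cons] at hl; omega
    simpa [step, next, headI_lists, apply_only, hx, hlt, ← update_lists, -natEnd] using h1

/-- A lone `Γ'.cons` encodes the list `[0]`, because `trNat 0` is empty. The loop thus starts with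
the state code `0`. -/
theorem reaches_start (p : Fin k → OmegaWord A) : P.Reaches p P.init
    (.read, 0, lists (K'.elim [Γ'.cons] [] [] []), []) := by
  refine Reaches.head ?_
  have h : Function.update (fun _ => []) K'.main [some Γ'.cons] =
      lists (K'.elim [Γ'.cons] [] [] []) := by
    funext i; cases i <;> rfl
  have h1 := Reaches.refl (p := p) (P := P) (.read, 0, lists (K'.elim [Γ'.cons] [] [] []), [])
  simpa [init, step, next, apply_only, ← h] using h1

theorem run_isSome [Finite A] (p : Fin k → OmegaWord A) (n : ℕ) :
    ∃ κ, P.machine.run p n = some κ := by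
  obtain ⟨κ, h, -⟩ := P.run_machine p n
  exact ⟨κ, h⟩

theorem exists_run_of_reaches [Finite A] {x : P.Conf} (h : P.Reaches p P.init x) :
    ∃ n κ, P.machine.run p n = some κ ∧ κ.out = x.2.2.2 := by
  obtain ⟨n, rfl⟩ := h
  obtain ⟨κ, h, -, -, -, h5⟩ := P.run_machine p n
  exact ⟨n, κ, h, h5⟩

end Loop

/-! ## Primitive recursive loops -/

theorem trPosNum_ne_nil (n : PosNum) : trPosNum n ≠ [] := by
  cases n <;> simp [trPosNum]

/-- The digits are listed from the least significant one. Only `one` and `bit1 a` could be confused,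
and they differ because the encoding of `a` is not empty. -/
theorem trPosNum_injective : Function.Injective trPosNum := by
  intro a
  induction a with
  | one => rintro (_ | b | b) h <;> simp_all [trPosNum, (trPosNum_ne_nil _).symm]
  | bit1 a ih =>
    rintro (_ | b | b) h
    · simp [trPosNum, trPosNum_ne_nil] at h
    · simp only [trPosNum, List.cons.injEq, true_and] at h
      rw [ih h]
    · simp [trPosNum] at h
  | bit0 a ih =>
    rintro (_ | b | b) h
    · simp [trPosNum] at h
    · simp [trPosNum] at h
    · simp only [trPosNum, List.cons.injEq, true_and] at h
      rw [ih h]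

/-- This lets the finite control recover an output symbol from its popped encoding by
`Function.invFun`. -/
theorem trNat_injective : Function.Injective trNat := by
  intro a b h
  have h' : trNum (a : Num) = trNum (b : Num) := h
  have : (a : Num) = (b : Num) := by
    generalize (a : Num) = x at h'
    generalize (b : Num) = y at h'
    rcases x with _ | x <;> rcases y with _ | y
    · rfl
    · exact absurd h'.symm (trPosNum_ne_nil y)
    · exact absurd h' (trPosNum_ne_nil x)
    · exact congrArg _ (trPosNum_injective h')
  exact_mod_cast this

/-- Push `l` on the main stack. -/
def pushAll {Λ σ : Type} : List Γ' → StackStmt Λ σ → StackStmt Λ σ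
  | [], q => q
  | x :: l, q => pushAll l (.push K'.main (fun _ => x) q)

theorem stepAux_pushAll {Λ σ : Type} (l : List Γ') (q : StackStmt Λ σ) (v : σ)
    (S : K' → List Γ') : TM2.stepAux (pushAll l q) v S =
      TM2.stepAux q v (Function.update S K'.main (l ++ S K'.main)) := by
  induction l generalizing q with
  | nil => simp [pushAll]
  | cons x l ih => simp [pushAll, ih]

theorem supportsStmt_pushAll {Λ σ : Type} {s : Finset Λ} (l : List Γ') {q : StackStmt Λ σ}
    (h : TM2.SupportsStmt s q) : TM2.SupportsStmt s (pushAll l q) := by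
  induction l generalizing q with
  | nil => exact h
  | cons x l ih => exact ih h

theorem exists_code₂ {f : ℕ → ℕ → ℕ} (hf : Primrec₂ f) :
    ∃ c : ToPartrec.Code, ∀ a b, c.eval [a, b] = pure [f a b] := by
  obtain ⟨c, hc⟩ := ToPartrec.Code.exists_code
    (Nat.Partrec'.prim (Nat.Primrec'.prim_iff₂.2 hf))
  refine ⟨c, fun a b => ?_⟩
  refine (hc ⟨[a, b], rfl⟩).trans ?_
  change Part.map pure (Part.some (f a b)) = Part.some [f a b]
  rw [Part.map_some]
  rfl

theorem exists_code_pair {f g : ℕ → ℕ → ℕ} (hf : Primrec₂ f) (hg : Primrec₂ g) :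
    ∃ c : ToPartrec.Code, ∀ a b, c.eval [a, b] = pure [f a b, g a b] := by
  obtain ⟨c, hc⟩ := exists_code₂ hf
  obtain ⟨d, hd⟩ := exists_code₂ hg
  exact ⟨.cons c d, fun a b => by simp [hc, hd]⟩

section CodeLoop

variable {A : Type u} {k : ℕ} [Primcodable A]

/-- The code of a column of input symbols. -/
def columnCode (a : Fin k → A) : ℕ := Primcodable.toEncodable.encode a

/-- The column with the given code. -/
def columnOfCode (n : ℕ) : Option (Fin k → A) := Primcodable.toEncodable.decode n

theorem columnOfCode_columnCode (a : Fin k → A) : columnOfCode (columnCode a) = some a :=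
  Primcodable.toEncodable.encodek a

/-- The loop that evaluates the code `c` in each round. -/
noncomputable def codeLoop (c : ToPartrec.Code) (B : ℕ) : Loop A k where
  Λ := Λ'
  σ := Option Γ'
  tr := tr
  load a := pushAll (trNat (columnCode a) ++ [Γ'.cons])
    (.goto fun _ => trNormal c Cont'.halt)
  v₀ := none
  dec := Function.invFun fun o : Option A => trNat (Encodable.encode o)
  bound := B
  support := codeSupp c Cont'.halt
  support_tr := (tr_supports c Cont'.halt).2
  support_load _ := supportsStmt_pushAll _ fun _ => (tr_supports c Cont'.halt).1

/-- Between rounds the main stack holds just the state code `s`. Pushing the code of the column on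
top of it yields the argument list of `c`; popping the first result afterwards leaves `s'` where `s`
was. -/
theorem codeLoop_round {c : ToPartrec.Code} {B : ℕ}
    (hB : ∀ o : Option A, (trNat (Encodable.encode o)).length ≤ B)
    {p : Fin k → OmegaWord A} {m s s' : ℕ} {o : Option A}
    (hc : c.eval [columnCode fun i => p i m, s] = pure [Encodable.encode o, s'])
    (out : List A) :
    (codeLoop c B).Reaches p
      (.read, m, Loop.lists (K'.elim (trList [s]) [] [] []), out)
      (.read, m + 1, Loop.lists (K'.elim (trList [s']) [] [] []), out ++ o.toList) := by
  refine Loop.Reaches.head ?_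
  have h1 := Loop.reaches_stepAux (P := codeLoop c B) (p := p) (m + 1) out
    ((codeLoop c B).load fun i => p i m) none (K'.elim (trList [s]) [] [] [])
  have h2 : TM2.stepAux ((codeLoop (A := A) c B).load fun i => p i m) none
      (K'.elim (trList [s]) [] [] []) =
      PartrecToTM2.init c [columnCode fun i => p i m, s] := by
    simp only [codeLoop]
    rw [stepAux_pushAll, K'.elim_update_main]
    simp [PartrecToTM2.init, trList]
  rw [h2] at h1
  have h3 : PartrecToTM2.halt [Encodable.encode o, s'] ∈ StateTransition.eval (TM2.step tr)
      (PartrecToTM2.init c [columnCode fun i => p i m, s]) := by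
    rw [tr_eval, hc]
    change _ ∈ Part.map halt (Part.some _)
    rw [Part.map_some]
    exact Part.mem_some _
  have h4 := Loop.reaches_ofCfg (P := codeLoop c B) (p := p) (m + 1) out
    (StateTransition.mem_eval.1 h3).1
  have h5 := Loop.reaches_post (P := codeLoop c B) (p := p) (m + 1) out
    (K'.elim (trList [Encodable.encode o, s']) [] [] []) (w := trNat (Encodable.encode o))
    (rest := trList [s']) (trNat_natEnd _) [] (by rw [List.nil_append]; exact hB o)
  rw [K'.elim_update_main, K'.elim_update_main] at h5
  have h6 : (codeLoop (k := k) c B).dec (trNat (Encodable.encode o)) = o :=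
    Function.leftInverse_invFun (f := fun o : Option A => trNat (Encodable.encode o))
      (trNat_injective.comp Encodable.encode_injective) o
  rw [List.nil_append, h6] at h5
  have h7 := (h1.trans h4).trans h5
  simp only [Loop.step, Loop.next, ListOp.apply_nop, cond_true, Option.toList_none,
    List.append_nil]
  exact h7

/-- A primitive recursive transducer can be performed by a Type-2 machine. -/
theorem exists_machine [Finite A] (F : ℕ → (Fin k → A) → ℕ) (G : ℕ → (Fin k → A) → Option A)
    (hF : Primrec₂ F) (hG : Primrec₂ G) : ∃ M : TypeTwoMachine A k,
      ∀ p : Fin k → OmegaWord A, (∀ n, ∃ c, M.run p n = some c) ∧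
      ∀ (s : ℕ → ℕ) (o : ℕ → List A), s 0 = 0 → o 0 = [] →
        (∀ m, s (m + 1) = F (s m) fun i => p i m) →
        (∀ m, o (m + 1) = o m ++ (G (s m) fun i => p i m).toList) →
        ∀ m, ∃ n c, M.run p n = some c ∧ c.out = o m := by
  obtain ⟨B, hB⟩ : ∃ B, ∀ o : Option A, (trNat (Encodable.encode o)).length ≤ B := by
    obtain ⟨B, hB⟩ := (Set.finite_range
      fun o : Option A => (trNat (Encodable.encode o)).length).bddAbove
    exact ⟨B, fun o => hB ⟨o, rfl⟩⟩
  have hdec : Primrec fun x : ℕ × ℕ => (columnOfCode x.1 : Option (Fin k → A)) :=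
    Primrec.decode.comp Primrec.fst
  -- The default value 0 is irrelevant: only codes of actual columns are pushed.
  obtain ⟨c, hc⟩ := exists_code_pair
    (f := fun a s => ((columnOfCode a : Option (Fin k → A)).map fun a =>
      Encodable.encode (G s a)).getD 0)
    (g := fun a s => ((columnOfCode a : Option (Fin k → A)).map fun a => F s a).getD 0)
    (Primrec.option_getD.comp (Primrec.option_map hdec (Primrec.encode.comp
      (hG.comp (Primrec.snd.comp Primrec.fst) Primrec.snd)).to₂) (Primrec.const 0))
    (Primrec.option_getD.comp (Primrec.option_map hdec
      (hF.comp (Primrec.snd.comp Primrec.fst) Primrec.snd).to₂) (Primrec.const 0))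
  refine ⟨(codeLoop c B).machine, fun p => ⟨Loop.run_isSome p, ?_⟩⟩
  intro s o hs ho hs' ho' m
  refine Loop.exists_run_of_reaches
    (x := (.read, m, Loop.lists (K'.elim (trList [s m]) [] [] []), o m)) ?_
  induction m with
  | zero =>
    rw [hs, ho]
    simpa using Loop.reaches_start (P := codeLoop c B) p
  | succ m ih =>
    refine ih.trans ?_
    rw [hs', ho']
    exact codeLoop_round hB (by simp [hc, columnOfCode_columnCode]) (o m)

end CodeLoop

/-! ### From primitive recursive approximations to Type-2 machines -/

section Transducer

variable {A : Type u} {k : ℕ}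

theorem IsPrefix.append_toList {w : List A} {q : OmegaWord A} (h : IsPrefix w q) {o : Option A}
    (ho : ∀ c, o = some c → c = q w.length) : IsPrefix (w ++ o.toList) q := by
  cases o with
  | none => simpa using h
  | some a =>
    intro i c hc
    rw [Option.toList_some, List.getElem?_append] at hc
    split_ifs at hc with hi
    · exact h i c hc
    · have h0 : i - w.length = 0 := by
        by_contra h0
        rw [List.getElem?_eq_none (by simp; omega)] at hc
        cases hc
      have : i = w.length := by omega
      subst this
      simp only [Nat.sub_self, List.getElem?_cons_zero, Option.some.injEq] at hc
      exact hc ▸ ho a rfl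

/-- The output produced in `m` rounds, if in each round one more symbol of each input is read and
one more symbol of the approximation is written if it is available. -/
def emitted (Φ : ℕ → (Fin k → List A) → List A) (p : Fin k → OmegaWord A) : ℕ → List A
  | 0 => []
  | m + 1 => emitted Φ p m ++
      ((Φ (m + 1) fun i => (p i).take (m + 1))[(emitted Φ p m).length]?).toList

variable {F : MultiFun (Fin k → OmegaWord A) (OmegaWord A)} {Φ : ℕ → (Fin k → List A) → List A}

theorem SeqApprox.isPrefix_emitted (h : SeqApprox F Φ) {p : Fin k → OmegaWord A}
    {q : OmegaWord A} (hq : q ∈ F p) (m : ℕ) : IsPrefix (emitted Φ p m) q := by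
  induction m with
  | zero => intro i c hc; simp [emitted] at hc
  | succ m ih =>
    exact ih.append_toList fun c hc => h.sound p q hq _ _ (fun i => .take_self _ _) _ c hc

theorem length_emitted_mono (p : Fin k → OmegaWord A) :
    Monotone fun m => (emitted Φ p m).length :=
  monotone_nat_of_le_succ fun m => by simp [emitted]

/-- After round `max m n` at least `j` symbols are written. If there are exactly `j`, the
approximation of the next round has more than `j` symbols, so that round writes one. -/
theorem SeqApprox.exists_le_length_emitted (h : SeqApprox F Φ) {p : Fin k → OmegaWord A}
    {q : OmegaWord A} (hq : q ∈ F p) (j : ℕ) : ∃ m, j ≤ (emitted Φ p m).length := by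
  induction j with
  | zero => exact ⟨0, Nat.zero_le _⟩
  | succ j ih =>
    obtain ⟨m, hm⟩ := ih
    obtain ⟨n, hn⟩ := h.complete p q hq (j + 1)
    have h1 : j ≤ (emitted Φ p (max m n)).length :=
      hm.trans (length_emitted_mono p (le_max_left m n))
    rcases h1.lt_or_eq with h2 | h2
    · exact ⟨_, h2⟩
    · refine ⟨max m n + 1, ?_⟩
      have hle : n ≤ max m n + 1 := (le_max_right m n).trans (Nat.le_succ _)
      have h3 := hn (max m n + 1) hle (fun i => (p i).take (max m n + 1))
        (fun i => .take_self _ _) fun i => by rwa [OmegaWord.length_take]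
      rw [emitted, ← h2, List.getElem?_eq_getElem h3]
      simp [← h2]

variable [Primcodable A]

/-- The state of the transducer: the columns that have been read, and the length of the
output. -/
abbrev ReaderState (A : Type u) (k : ℕ) := List (Fin k → A) × ℕ

/-- The code of a state. -/
def ReaderState.code (x : ReaderState A k) : ℕ := Primcodable.toEncodable.encode x

/-- The state with the given code. -/
def ReaderState.ofCode (n : ℕ) : ReaderState A k :=
  (Primcodable.toEncodable.decode n).getD ([], 0)

theorem ReaderState.ofCode_code (x : ReaderState A k) : ofCode x.code = x := by
  rw [ofCode, code, Primcodable.toEncodable.encodek]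
  rfl

theorem primrec_map_apply (i : Fin k) :
    Primrec fun l : List (Fin k → A) => l.map fun a => a i :=
  Primrec.list_map Primrec.id (Primrec.pi_apply Primrec.snd i).to₂

variable [Finite A]

/-- A function with a primitive recursive approximation is computed by a Type-2 machine. -/
theorem SeqApprox.exists_machine (h : SeqApprox F Φ)
    (hΦ : Primrec fun x : ℕ × (Fin k → List A) => Φ x.1 x.2) :
    ∃ M : TypeTwoMachine A k, ∀ p, ∀ q ∈ F p, M.OutputsSeq p q := by
  -- Each round evaluates `Φ` anew on all columns read so far, so the state stores these, but only
  -- the number of symbols already written. The time is the number of columns.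
  let word : ReaderState A k → (Fin k → A) → Option A := fun x a =>
    (Φ (x.1 ++ [a]).length fun i => (x.1 ++ [a]).map fun a => a i)[x.2]?
  have hcols : Primrec fun y : ReaderState A k × (Fin k → A) => y.1.1 ++ [y.2] :=
    Primrec.list_concat.comp (Primrec.fst.comp Primrec.fst) Primrec.snd
  have hword : Primrec₂ word := Primrec.list_getElem?.comp
    (hΦ.comp (Primrec.pair (Primrec.list_length.comp hcols)
      (Primrec.pi_mk fun i => (primrec_map_apply i).comp hcols)))
    (Primrec.snd.comp Primrec.fst)
  have hof : Primrec (ReaderState.ofCode (A := A) (k := k)) :=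
    Primrec.option_getD.comp Primrec.decode (Primrec.const _)
  have hcode : Primrec (ReaderState.code (A := A) (k := k)) := Primrec.encode
  let next : ReaderState A k → (Fin k → A) → ReaderState A k := fun x a =>
    (x.1 ++ [a], x.2 + (word x a).toList.length)
  have hnext : Primrec₂ next := Primrec.pair hcols (Primrec.nat_add.comp
    (Primrec.snd.comp Primrec.fst) (Primrec.list_length.comp (Primrec.optionToList.comp hword)))
  obtain ⟨M, hM⟩ := TTE.exists_machine (fun n a => (next (.ofCode n) a).code)
    (fun n a => word (.ofCode n) a)
    (hcode.comp (hnext.comp (hof.comp Primrec.fst) Primrec.snd))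
    (hword.comp (hof.comp Primrec.fst) Primrec.snd)
  refine ⟨M, fun p q hq => ⟨(hM p).1, fun j => ?_⟩⟩
  let cols : ℕ → List (Fin k → A) := fun m => (List.range m).map fun m' i => p i m'
  have hcols' : ∀ m, cols m ++ [fun i => p i m] = cols (m + 1) := fun m => by
    simp [cols, List.range_succ]
  have hw : ∀ m, word (cols m, (emitted Φ p m).length) (fun i => p i m) =
      (Φ (m + 1) fun i => (p i).take (m + 1))[(emitted Φ p m).length]? := fun m => by
    simp only [word, hcols']
    have h1 : (cols (m + 1)).length = m + 1 := by simp [cols]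
    have h2 : ∀ i, ((cols (m + 1)).map fun a => a i) = (p i).take (m + 1) := fun i => by
      simp [cols, OmegaWord.take, Function.comp_def]
    rw [h1]
    simp only [h2]
  obtain ⟨m, hm⟩ := h.exists_le_length_emitted hq (j + 1)
  -- The first `rfl` below uses that the initial state `([], 0)` has code 0.
  obtain ⟨n, c, hn, hc⟩ := (hM p).2
    (fun m => ReaderState.code (cols m, (emitted Φ p m).length)) (emitted Φ p) rfl rfl
    (fun m => by
      rw [ReaderState.ofCode_code]
      simp only [next, hw, hcols']
      simp [emitted])
    (fun m => by rw [ReaderState.ofCode_code, hw]; rfl) m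
  exact ⟨n, c, hn, by rw [hc]; exact (h.isPrefix_emitted hq m).getElem?_eq hm⟩

/-- The machine may also produce sequences outside the domain of `g`, so what it computes is an
extension of `g`. -/
theorem SeqApprox.computable {g : (Fin k → OmegaWord A) →. OmegaWord A}
    (h : SeqApprox (MultiFun.ofPFun g) Φ)
    (hΦ : Primrec fun x : ℕ × (Fin k → List A) => Φ x.1 x.2) : ComputableSeq g := by
  obtain ⟨M, hM⟩ := h.exists_machine hΦ
  obtain ⟨f, hf⟩ := MultiFun.exists_eq_ofPFun (F := fun p => {q | M.OutputsSeq p q})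
    fun p q hq q' hq' => TypeTwoMachine.OutputsSeq.unique hq hq'
  have hf' : ∀ p q, q ∈ f p ↔ M.OutputsSeq p q := fun p q =>
    (Set.ext_iff.1 (congrFun hf p) q).symm
  exact ⟨f, ⟨M, hf'⟩, fun p q hq => (hf' p q).2 (hM p q hq)⟩

end Transducer

/-! ### Approximations for the statements, and the theorem -/

theorem Stmt.IsContinuous.hasApprox {A : Type u} [Zero A] [One A] [Primcodable A] {L : ℕ}
    {Γ Lab : Type} {s : Stmt A (fun _ : Fin (L + 1) => OmegaWord A) Γ Lab}
    (hs : s.IsContinuous) : s.HasApprox False := by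
  cases s with
  | assign i n arg f l =>
    obtain ⟨g, rfl, hg⟩ := hs
    obtain ⟨Φ, hΦ⟩ := exists_seqApprox_of_continuous hg
    exact ⟨Φ, hΦ, False.elim⟩
  | test n arg f hf l₁ l₂ =>
    obtain ⟨Ψ, hΨ⟩ := exists_wordApprox_of_continuous hs
    exact ⟨Ψ, hΨ, False.elim⟩
  | _ => trivial

theorem Stmt.IsComputable.hasApprox {A : Type u} [Zero A] [One A] [Finite A] [Primcodable A]
    {L : ℕ} {Γ Lab : Type} {s : Stmt A (fun _ : Fin (L + 1) => OmegaWord A) Γ Lab}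
    (hs : s.IsComputable) : s.HasApprox True := by
  cases s with
  | assign i n arg f l =>
    obtain ⟨g, rfl, hg⟩ := hs
    obtain ⟨Φ, hΦ, hp⟩ := hg.exists_seqApprox
    exact ⟨Φ, hΦ, fun _ => hp⟩
  | test n arg f hf l₁ l₂ =>
    obtain ⟨Ψ, hΨ, hp⟩ := ComputableWord.exists_wordApprox hs
    exact ⟨Ψ, hΨ, fun _ => hp⟩
  | _ => trivial

end TTE

theorem theoremt3 {A : Type*} [Finite A] [Zero A] [One A] [NeZero (1 : A)] {k L : ℕ}
    (N : TTE.GTM A k L (fun _ => TTE.OmegaWord A)) :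
    ((∀ l, (N.stm l).IsContinuous) →
      ∃ g : (Fin k → TTE.OmegaWord A) →. TTE.OmegaWord A,
        N.multiFun = TTE.MultiFun.ofPFun g ∧ TTE.PFunContinuous g) ∧
    ((∀ l, (N.stm l).IsComputable) →
      ∃ g : (Fin k → TTE.OmegaWord A) →. TTE.OmegaWord A,
        N.multiFun = TTE.MultiFun.ofPFun g ∧ TTE.ComputableSeq g) := by
  let := Primcodable.ofFinite A
  let := Primcodable.ofFinite N.Γ
  let := Primcodable.ofFinite N.Label
  refine ⟨fun h => ?_, fun h => ?_⟩
  · obtain ⟨Φ, hΦ, -⟩ := TTE.exists_seqApprox_multiFun (N := N) fun l => (h l).hasApprox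
    obtain ⟨g, hg⟩ := hΦ.exists_eq_ofPFun
    have hΦ' : TTE.SeqApprox (TTE.MultiFun.ofPFun g) Φ := hg ▸ hΦ
    exact ⟨g, hg, hΦ'.continuous⟩
  · obtain ⟨Φ, hΦ, hp⟩ := TTE.exists_seqApprox_multiFun (N := N) fun l => (h l).hasApprox
    obtain ⟨g, hg⟩ := hΦ.exists_eq_ofPFun
    have hΦ' : TTE.SeqApprox (TTE.MultiFun.ofPFun g) Φ := hg ▸ hΦ
    exact ⟨g, hg, hΦ'.computable (hp trivial)⟩
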